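/- Let $n\ge 0$ be an integer and $a\in\mathbb{C}$, $a\neq 0$. Let $D_n(x,a)$ and $F_n(x,a)$ be the Dickson polynomials of the first and of the third kind with parameter $a$: for $n\ge 1$, $$D_n(x,a)=\sum_{i=0}^{\lfloor n/2\rfloor}\frac{n}{n-i}\binom{n-i}{i}(-a)^i x^{n-2i},\qquad F_n(x,a)=\sum_{i=0}^{\lfloor n/2\rfloor}\frac{n-2i}{n-i}\binom{n-i}{i}(-a)^i x^{n-2i},$$ and $D_0=2$, $F_0=0$. Consider $$(x^2-4a)F''+3xF'-n^2F=2n\,D_n(x,a)\qquad(1)$$ and the associated homogeneous equation $$(x^2-4a)F''+3xF'-n^2F=0.\qquad(2)$$ (i) Particular solution. Let $b_0,\dots,b_n\in\mathbb{C}$ and put $b_{n+1}=b_{n+2}=0$. The polynomial $F_p(x)=\sum_{k=0}^n b_kx^k$ satisfies (1) if and only if for all $0\le k\le n$ $$b_{k+2}=-\frac{n^2-k(k+2)}{4a(k+2)(k+1)}\,b_k\quad\text{if } n\not\equiv k \pmod 2,$$ $$b_{k+2}=\frac{1}{4a(k+2)(k+1)}\Big\{[k(k+2)-n^2]\,b_k-2n\,d_{k}\Big\}\quad\text{if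 } n\equiv k \pmod 2,$$ where $d_k$ is the coefficient of $x^{k}=x^{n-2i}$, $i=\frac{n-k}{2}$, in $D_n(x,a)$. Such $b_0,\dots,b_n$ exist. (ii) General solution of (2). Put $\nu=\sqrt{n^2+1}-\frac12$ and let $\sqrt a$ be either square root of $a$. Let $V\subseteq\mathbb{C}$ be open and connected, and let $\sqrt[4]{x^2-4a}$ be any continuous branch of the fourth root on $V$. Suppose that one of the following holds: (a) $\frac{x}{2\sqrt a}\notin(-\infty,1]$ for all $x\in V$, and $P_\nu^{1/2}$, $Q_\nu^{1/2}$ are the associated Legendre functions of the first and second kinds on $\mathbb{C}\setminus(-\infty,1]$; (b) $\frac{x}{2\sqrt a}\notin(-\infty,-1]\cup[1,\infty)$ for all $x\in V$, and $P_\nu^{1/2}$, $Q_\nu^{1/2}$ are the associated Legendre functions on the interval $(-1,1)$ (Ferrers functions), continued analytically to $\mathbb{C}\setminus((-\infty,-1]\cup[1,\infty))$. Then a function $F:V\to\mathbb{C}$ is a holomorphic solution of (2) on $V$ if and only if there are constants $A,B\in\mathbb{C}$ with $F=F_c$ on $V$, where $$F_c(x)=\frac{1}{\sqrt[4]{x^2-4a}}\Big[A\,P_\nu^{1/2}\Big(\frac{x}{2\sqrt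 a}\Big)+B\,Q_\nu^{1/2}\Big(\frac{x}{2\sqrt a}\Big)\Big].$$ (iii) General solution of (1). In the situation of (ii), let $F_p$ be as in (i), with coefficients satisfying the recurrences. Then a function $F:V\to\mathbb{C}$ is a holomorphic solution of (1) on $V$ if and only if $F=F_c+F_p$ on $V$ for some constants $A,B\in\mathbb{C}$. In particular, there are constants $A,B\in\mathbb{C}$ with $F_n(x,a)=F_c(x)+F_p(x)$ for all $x\in V$. -/

import Mathlib

/-- The plane cut along `[1, ∞)`, the domain of the principal branch of Gauss's function. -/
def hypergeometricDomain : Set ℂ := {w | 1 - w ∈ Complex.slitPlane}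

/-- `f` is the analytic continuation of Gauss's series `₂F₁(a, b; c; w)`, `|w| < 1`, to the
plane cut along `[1, ∞)`. -/
def IsHypergeometricContinuation (a b c : ℂ) (f : ℂ → ℂ) : Prop :=
  DifferentiableOn ℂ f hypergeometricDomain ∧
    ∀ w ∈ Metric.ball (0 : ℂ) 1, f w = ordinaryHypergeometric a b c w

open Classical in
/-- The principal branch of Gauss's hypergeometric function `F(a, b; c; w)`: the analytic
continuation of the power series to the plane cut along `[1, ∞)`. (Should there be no
continuation, the power series itself is taken; so the values on the unit disk are always those
of the series.) -/
noncomputable def hypergeometricF (a b c : ℂ) : ℂ → ℂ :=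
  if h : ∃ f : ℂ → ℂ, IsHypergeometricContinuation a b c f then h.choose
  else ordinaryHypergeometric a b c

theorem hypergeometricF_eq_series (a b c : ℂ) {w : ℂ} (hw : w ∈ Metric.ball (0 : ℂ) 1) :
    hypergeometricF a b c w = ordinaryHypergeometric a b c w := by
  unfold hypergeometricF
  split_ifs with h
  · exact h.choose_spec.2 w hw
  · rfl

/-- The continuation is unique, so `hypergeometricF` does not depend on a choice. -/
theorem hypergeometricF_eq_of_continuation {a b c : ℂ} {f : ℂ → ℂ}
    (hf : IsHypergeometricContinuation a b c f) {w : ℂ} (hw : w ∈ hypergeometricDomain) :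
    hypergeometricF a b c w = f w := by
  have hopen : IsOpen hypergeometricDomain :=
    Complex.isOpen_slitPlane.preimage (continuous_const.sub continuous_id)
  have hconn : IsPreconnected hypergeometricDomain := by
    have h1 : IsPreconnected Complex.slitPlane :=
      (Complex.starConvex_one_slitPlane.isPathConnected
        Complex.one_mem_slitPlane).isConnected.isPreconnected
    have h2 : hypergeometricDomain = (fun w : ℂ => 1 - w) '' Complex.slitPlane := by
      ext w
      constructor
      · intro h
        exact ⟨1 - w, h, by ring⟩
      · rintro ⟨v, hv, rfl⟩
        simpa [hypergeometricDomain] using hv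
    rw [h2]
    exact h1.image _ (continuous_const.sub continuous_id).continuousOn
  have hex : ∃ f : ℂ → ℂ, IsHypergeometricContinuation a b c f := ⟨f, hf⟩
  have hF : IsHypergeometricContinuation a b c (hypergeometricF a b c) := by
    unfold hypergeometricF
    rw [dif_pos hex]
    exact hex.choose_spec
  have h0 : (0 : ℂ) ∈ hypergeometricDomain := by simp [hypergeometricDomain]
  refine (hF.1.analyticOnNhd hopen).eqOn_of_preconnected_of_eventuallyEq
    (hf.1.analyticOnNhd hopen) hconn h0 ?_ hw
  filter_upwards [Metric.ball_mem_nhds (0 : ℂ) one_pos] with v hv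
  rw [hF.2 v hv, hf.2 v hv]

/-- The plane cut along `(-∞, 1]`, where the associated Legendre functions of a complex
argument are holomorphic. -/
def legendreDomain : Set ℂ := {z | z - 1 ∈ Complex.slitPlane}

/-- The associated Legendre function of the first kind `P_ν^μ(z)` on the plane cut along
`(-∞, 1]`. -/
noncomputable def assocLegendreP (ν μ z : ℂ) : ℂ :=
  1 / Complex.Gamma (1 - μ) * ((z + 1) / (z - 1)) ^ (μ / 2) *
    hypergeometricF (-ν) (ν + 1) (1 - μ) ((1 - z) / 2)

/-- The associated Legendre function of the second kind `Q_ν^μ(z)` on the plane cut along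
`(-∞, 1]`. The factor `(z ^ 2 - 1) ^ (μ / 2)` is the branch that is holomorphic there and positive
for `z > 1` and real `μ`. -/
noncomputable def assocLegendreQ (ν μ z : ℂ) : ℂ :=
  Complex.exp (μ * Real.pi * Complex.I) *
    ((Real.sqrt Real.pi : ℂ) * Complex.Gamma (ν + μ + 1) /
      ((2 : ℂ) ^ (ν + 1) * Complex.Gamma (ν + 3 / 2))) *
    ((z - 1) ^ (μ / 2) * (z + 1) ^ (μ / 2) / z ^ (ν + μ + 1)) *
    hypergeometricF ((ν + μ + 1) / 2) ((ν + μ + 2) / 2) (ν + 3 / 2) (1 / z ^ 2)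

/-- The plane cut along `(-∞, -1]` and `[1, ∞)`; it contains the interval `(-1, 1)`. -/
def ferrersDomain : Set ℂ := {z | 1 - z ∈ Complex.slitPlane ∧ 1 + z ∈ Complex.slitPlane}

/-- The associated Legendre function of the first kind on the interval `(-1, 1)`
(Ferrers function), continued to the plane cut along `(-∞, -1]` and `[1, ∞)`. -/
noncomputable def ferrersP (ν μ z : ℂ) : ℂ :=
  1 / Complex.Gamma (1 - μ) * ((1 + z) / (1 - z)) ^ (μ / 2) *
    hypergeometricF (-ν) (ν + 1) (1 - μ) ((1 - z) / 2)

/-- The associated Legendre function of the second kind on the interval `(-1, 1)`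
(Ferrers function), continued to the plane cut along `(-∞, -1]` and `[1, ∞)`, for `μ` not an
integer. -/
noncomputable def ferrersQ (ν μ z : ℂ) : ℂ :=
  Real.pi / (2 * Complex.sin (μ * Real.pi)) *
    (Complex.cos (μ * Real.pi) * ferrersP ν μ z -
      Complex.Gamma (ν + μ + 1) / Complex.Gamma (ν - μ + 1) * ferrersP ν (-μ) z)

/-- The `n`-th Dickson polynomial of the first kind `D_n(x, a)`. -/
noncomputable def dicksonD (n : ℕ) (a : ℂ) : Polynomial ℂ := Polynomial.dickson 1 a n

/-- The `n`-th Dickson polynomial of the third kind `F_n(x, a)`. -/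
noncomputable def dicksonF (n : ℕ) (a : ℂ) : Polynomial ℂ := Polynomial.dickson 3 a n

/-- `(x² - 4a) F'' + 3x F' - n² F` at the point `x`. -/
noncomputable def dicksonOperator (n : ℕ) (a : ℂ) (F : ℂ → ℂ) (x : ℂ) : ℂ :=
  (x ^ 2 - 4 * a) * deriv (deriv F) x + 3 * x * deriv F x - (n : ℂ) ^ 2 * F x

/-- `F` is a holomorphic solution on `V` of `(x² - 4a) F'' + 3x F' - n² F = 0`. -/
def IsHomogeneousSolution (n : ℕ) (a : ℂ) (V : Set ℂ) (F : ℂ → ℂ) : Prop :=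
  DifferentiableOn ℂ F V ∧ ∀ x ∈ V, dicksonOperator n a F x = 0

/-- `F` is a holomorphic solution on `V` of `(x² - 4a) F'' + 3x F' - n² F = 2n D_n(x, a)`. -/
def IsInhomogeneousSolution (n : ℕ) (a : ℂ) (V : Set ℂ) (F : ℂ → ℂ) : Prop :=
  DifferentiableOn ℂ F V ∧
    ∀ x ∈ V, dicksonOperator n a F x = 2 * (n : ℂ) * (dicksonD n a).eval x

/-- The two-step recurrences for the coefficients `b_0, …, b_n`, for `0 ≤ k ≤ n`
(with the coefficients `b_{n+1}`, `b_{n+2}` in the last two of them). -/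
def DicksonRecurrence (n : ℕ) (a : ℂ) (b : ℕ → ℂ) : Prop :=
  ∀ k ≤ n,
    ((Odd n ∧ Even k ∨ Even n ∧ Odd k) →
      b (k + 2) =
        -(((n : ℂ) ^ 2 - k * (k + 2)) / (4 * a * (k + 2) * (k + 1))) * b k) ∧
    ((Odd n ∧ Odd k ∨ Even n ∧ Even k) →
      b (k + 2) =
        1 / (4 * a * (k + 2) * (k + 1)) *
          (((k : ℂ) * (k + 2) - (n : ℂ) ^ 2) * b k
            - 2 * n * (dicksonD n a).coeff (n - 2 * ((n - k) / 2))))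

/-- `F_p(x) = ∑_{k=0}^{n} b_k x^k`. -/
noncomputable def particularSolution (n : ℕ) (b : ℕ → ℂ) (x : ℂ) : ℂ :=
  ∑ k ∈ Finset.range (n + 1), b k * x ^ k

/-- The degree `ν = √(n² + 1) - 1/2`. -/
noncomputable def legendreDegree (n : ℕ) : ℂ := (Real.sqrt ((n : ℝ) ^ 2 + 1) : ℂ) - 1 / 2

/-- `F_c(x) = (x² - 4a)^{-1/4} [A P(x / (2√a)) + B Q(x / (2√a))]`, where `g` is the chosen branch
of the fourth root of `x² - 4a` and `r` the chosen square root of `a`. -/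
noncomputable def complementarySolution (P Q g : ℂ → ℂ) (r A B x : ℂ) : ℂ :=
  1 / g x * (A * P (x / (2 * r)) + B * Q (x / (2 * r)))

/-!
Put `z = x / (2√a)` and `s = √(n² + 1)`. The fourth root of `x² - 4a` is the gauge factor that turns
(2) into the associated Legendre equation of degree `s - 1/2` and order `1/2` in `z`, and at order
`1/2` a branch of `(1 - z²) ^ (-1/4)` turns that equation in turn into Chebyshev's equation
`(1 - z²) u'' - z u' + s² u = 0`, whose solutions are elementary: `cos (s arccos z)`,
`sin (s arccos z)` and `(z + √(z² - 1)) ^ (-s)`. The hypergeometric functions in the definitions of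
`P` and `Q` are therefore elementary too; they are identified by checking that the elementary
function solves Gauss's equation on the whole cut plane and takes the value `1` at `0`, which
determines its Taylor coefficients. The first integral `s² u² + (1 - z²) u'² = s²` of
`u = cos (s arccos z)` keeps the Wronskians away from zero, and a pair of solutions with
nonvanishing Wronskian spans all solutions on a connected open set.

For (1), comparing coefficients yields the recurrences, and the polynomial of the third kind `F_n`
is itself a particular solution.
-/

/-! ### Second-order linear differential equations -/

/-- `y` is a holomorphic solution on `V` of the linear equation `p₂ y'' + p₁ y' + p₀ y = 0`. -/
def IsLinearODESolution (p₂ p₁ p₀ : ℂ → ℂ) (V : Set ℂ) (y : ℂ → ℂ) : Prop :=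
  DifferentiableOn ℂ y V ∧
    ∀ x ∈ V, p₂ x * deriv (deriv y) x + p₁ x * deriv y x + p₀ x * y x = 0

namespace IsLinearODESolution

variable {p₂ p₁ p₀ q₂ q₁ q₀ y u : ℂ → ℂ} {U V : Set ℂ} {x : ℂ}

theorem hasDerivAt (h : IsLinearODESolution p₂ p₁ p₀ V y) (hV : IsOpen V) (hx : x ∈ V) :
    HasDerivAt y (deriv y x) x :=
  (h.1.differentiableAt (hV.mem_nhds hx)).hasDerivAt

theorem hasDerivAt_deriv (h : IsLinearODESolution p₂ p₁ p₀ V y) (hV : IsOpen V) (hx : x ∈ V) :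
    HasDerivAt (deriv y) (deriv (deriv y) x) x :=
  ((h.1.deriv hV).differentiableAt (hV.mem_nhds hx)).hasDerivAt

theorem of_hasDerivAt {y' y'' : ℂ → ℂ} (hV : IsOpen V) (hy : ∀ x ∈ V, HasDerivAt y (y' x) x)
    (hy' : ∀ x ∈ V, HasDerivAt y' (y'' x) x)
    (hode : ∀ x ∈ V, p₂ x * y'' x + p₁ x * y' x + p₀ x * y x = 0) :
    IsLinearODESolution p₂ p₁ p₀ V y := by
  refine ⟨fun x hx => (hy x hx).differentiableAt.differentiableWithinAt, fun x hx => ?_⟩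
  have hderiv : deriv y =ᶠ[nhds x] y' := by
    filter_upwards [hV.mem_nhds hx] with v hv using (hy v hv).deriv
  rw [hderiv.deriv_eq, (hy' x hx).deriv, (hy x hx).deriv]
  exact hode x hx

theorem congr (h : IsLinearODESolution p₂ p₁ p₀ V y) (hV : IsOpen V) (hu : Set.EqOn u y V) :
    IsLinearODESolution p₂ p₁ p₀ V u :=
  of_hasDerivAt hV
    (fun _ hx => (h.hasDerivAt hV hx).congr_of_eventuallyEq
      (Filter.eventuallyEq_of_mem (hV.mem_nhds hx) hu))
    (fun _ hx => h.hasDerivAt_deriv hV hx) (fun x hx => by rw [hu hx]; exact h.2 x hx)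

theorem rescale (h : IsLinearODESolution p₂ p₁ p₀ V y) (m : ℂ → ℂ)
    (h₂ : ∀ x ∈ V, q₂ x = m x * p₂ x) (h₁ : ∀ x ∈ V, q₁ x = m x * p₁ x)
    (h₀ : ∀ x ∈ V, q₀ x = m x * p₀ x) : IsLinearODESolution q₂ q₁ q₀ V y :=
  ⟨h.1, fun x hx => by
    rw [h₂ x hx, h₁ x hx, h₀ x hx]; linear_combination m x * h.2 x hx⟩

theorem linearCombination {f g : ℂ → ℂ} (hf : IsLinearODESolution p₂ p₁ p₀ V f)
    (hg : IsLinearODESolution p₂ p₁ p₀ V g) (hV : IsOpen V) (A B : ℂ) :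
    IsLinearODESolution p₂ p₁ p₀ V (fun x => A * f x + B * g x) :=
  of_hasDerivAt hV
    (fun _ hx => ((hf.hasDerivAt hV hx).const_mul A).add ((hg.hasDerivAt hV hx).const_mul B))
    (fun _ hx => ((hf.hasDerivAt_deriv hV hx).const_mul A).add
      ((hg.hasDerivAt_deriv hV hx).const_mul B))
    (fun x hx => by linear_combination A * hf.2 x hx + B * hg.2 x hx)

theorem const_mul (h : IsLinearODESolution p₂ p₁ p₀ V y) (hV : IsOpen V) (A : ℂ) :
    IsLinearODESolution p₂ p₁ p₀ V (fun x => A * y x) := by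
  simpa using h.linearCombination h hV A 0

protected theorem deriv {c : ℂ} {p₂' p₁' : ℂ → ℂ} (h : IsLinearODESolution p₂ p₁ (fun _ => c) V y)
    (hV : IsOpen V) (h₂ : ∀ x ∈ V, HasDerivAt p₂ (p₂' x) x)
    (h₁ : ∀ x ∈ V, HasDerivAt p₁ (p₁' x) x) :
    IsLinearODESolution p₂ (fun x => p₁ x + p₂' x) (fun x => c + p₁' x) V (deriv y) := by
  refine ⟨h.1.deriv hV, fun x hx => ?_⟩
  have hy'' := (((h.1.deriv hV).deriv hV).differentiableAt (hV.mem_nhds hx)).hasDerivAt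
  have hlhs := (((h₂ x hx).mul hy'').add ((h₁ x hx).mul (h.hasDerivAt_deriv hV hx))).add
    ((h.hasDerivAt hV hx).const_mul c)
  have hzero := hlhs.congr_of_eventuallyEq (f₁ := fun _ => (0 : ℂ))
    (Filter.eventuallyEq_of_mem (hV.mem_nhds hx) fun v hv => (h.2 v hv).symm)
  linear_combination hzero.unique (hasDerivAt_const x 0)

theorem comp_affine (h : IsLinearODESolution p₂ p₁ p₀ U y) (hU : IsOpen U) (hV : IsOpen V)
    {α β : ℂ} (hmaps : ∀ x ∈ V, α * x + β ∈ U) :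
    IsLinearODESolution (fun x => p₂ (α * x + β)) (fun x => α * p₁ (α * x + β))
      (fun x => α ^ 2 * p₀ (α * x + β)) V (fun x => y (α * x + β)) := by
  have hℓ (x : ℂ) : HasDerivAt (fun x => α * x + β) α x := by
    simpa using ((hasDerivAt_id' x).const_mul α).add_const β
  refine of_hasDerivAt hV (y' := fun x => α * deriv y (α * x + β))
    (y'' := fun x => α ^ 2 * deriv (deriv y) (α * x + β))
    (fun x hx => ?_) (fun x hx => ?_) fun x hx => ?_
  · exact ((h.hasDerivAt hU (hmaps x hx)).comp x (hℓ x)).congr_deriv (mul_comm _ _)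
  · refine (((h.hasDerivAt_deriv hU (hmaps x hx)).comp x (hℓ x)).const_mul α).congr_deriv ?_
    ring
  · linear_combination α ^ 2 * h.2 _ (hmaps x hx)

theorem gauge {e ρ ρ' : ℂ → ℂ} (h : IsLinearODESolution p₂ p₁ p₀ V y) (hV : IsOpen V)
    (he : ∀ x ∈ V, HasDerivAt e (ρ x * e x) x) (hρ : ∀ x ∈ V, HasDerivAt ρ (ρ' x) x)
    (h₁ : ∀ x ∈ V, p₁ x = q₁ x + 2 * ρ x * p₂ x)
    (h₀ : ∀ x ∈ V, p₀ x = q₀ x + ρ x * q₁ x + (ρ' x + ρ x ^ 2) * p₂ x) :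
    IsLinearODESolution p₂ q₁ q₀ V (fun x => e x * y x) :=
  of_hasDerivAt hV
    (fun x hx => (he x hx).mul (h.hasDerivAt hV hx))
    (fun x hx => (((hρ x hx).fun_mul (he x hx)).mul (h.hasDerivAt hV hx)).add
      ((he x hx).mul (h.hasDerivAt_deriv hV hx)))
    (fun x hx => by
      linear_combination e x * h.2 x hx - e x * deriv y x * h₁ x hx - e x * y x * h₀ x hx)

end IsLinearODESolution

/-- The Wronskian `f g' - f' g` of two holomorphic functions. -/
noncomputable def wronskian (f g : ℂ → ℂ) (x : ℂ) : ℂ := f x * deriv g x - deriv f x * g x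

/-- `f` and `g` are solutions of `p₂ y'' + p₁ y' + p₀ y = 0` on `V` that are linearly independent,
expressed by their Wronskian having no zero in `V`. -/
structure IsFundamentalSystem (p₂ p₁ p₀ : ℂ → ℂ) (V : Set ℂ) (f g : ℂ → ℂ) : Prop where
  left : IsLinearODESolution p₂ p₁ p₀ V f
  right : IsLinearODESolution p₂ p₁ p₀ V g
  wronskian_ne_zero : ∀ x ∈ V, wronskian f g x ≠ 0

theorem IsLinearODESolution.hasDerivAt_wronskian {p₂ p₁ p₀ f g : ℂ → ℂ} {V : Set ℂ}
    (hf : IsLinearODESolution p₂ p₁ p₀ V f) (hg : IsLinearODESolution p₂ p₁ p₀ V g)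
    (hV : IsOpen V) {x : ℂ} (hx : x ∈ V) (hp₂ : p₂ x ≠ 0) :
    HasDerivAt (wronskian f g) (-(p₁ x / p₂ x) * wronskian f g x) x := by
  refine (((hf.hasDerivAt hV hx).mul (hg.hasDerivAt_deriv hV hx)).sub
    ((hf.hasDerivAt_deriv hV hx).mul (hg.hasDerivAt hV hx))).congr_deriv ?_
  unfold wronskian
  field_simp
  linear_combination f x * hg.2 x hx - g x * hf.2 x hx

theorem exists_eqOn_const_mul_of_hasDerivAt {V : Set ℂ} (hV : IsOpen V) (hc : IsPreconnected V)
    {ρ u v : ℂ → ℂ} (hu : ∀ x ∈ V, HasDerivAt u (ρ x * u x) x)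
    (hv : ∀ x ∈ V, HasDerivAt v (ρ x * v x) x) (hv0 : ∀ x ∈ V, v x ≠ 0) :
    ∃ A : ℂ, ∀ x ∈ V, u x = A * v x := by
  have hquot (x : ℂ) (hx : x ∈ V) : HasDerivAt (fun x => u x / v x) 0 x :=
    ((hu x hx).div (hv x hx) (hv0 x hx)).congr_deriv (by
      rw [div_eq_zero_iff]; left; ring)
  obtain ⟨A, hA⟩ := hV.exists_is_const_of_deriv_eq_zero hc
    (fun x hx => (hquot x hx).differentiableAt.differentiableWithinAt)
    (fun x hx => (hquot x hx).deriv)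
  exact ⟨A, fun x hx => by rw [← hA x hx, div_mul_cancel₀ _ (hv0 x hx)]⟩

namespace IsFundamentalSystem

variable {p₂ p₁ p₀ q₂ q₁ q₀ f g f₁ g₁ F : ℂ → ℂ} {U V : Set ℂ}

theorem isLinearODESolution_iff (h : IsFundamentalSystem p₂ p₁ p₀ V f g) (hV : IsOpen V)
    (hc : IsPreconnected V) (hp₂ : ∀ x ∈ V, p₂ x ≠ 0) :
    IsLinearODESolution p₂ p₁ p₀ V F ↔ ∃ A B : ℂ, ∀ x ∈ V, F x = A * f x + B * g x := by
  refine ⟨fun hF => ?_, fun ⟨A, B, hAB⟩ =>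
    (h.left.linearCombination h.right hV A B).congr hV hAB⟩
  have hW (x : ℂ) (hx : x ∈ V) := h.left.hasDerivAt_wronskian h.right hV hx (hp₂ x hx)
  -- Cramer's rule, with coefficients that are constant since all Wronskians satisfy the same
  -- first-order equation
  obtain ⟨A, hA⟩ := exists_eqOn_const_mul_of_hasDerivAt hV hc
    (fun x hx => hF.hasDerivAt_wronskian h.right hV hx (hp₂ x hx)) hW h.wronskian_ne_zero
  obtain ⟨B, hB⟩ := exists_eqOn_const_mul_of_hasDerivAt hV hc
    (fun x hx => h.left.hasDerivAt_wronskian hF hV hx (hp₂ x hx)) hW h.wronskian_ne_zero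
  refine ⟨A, B, fun x hx => mul_left_cancel₀ (h.wronskian_ne_zero x hx) ?_⟩
  have hAx := hA x hx
  have hBx := hB x hx
  unfold wronskian at hAx hBx ⊢
  linear_combination f x * hAx + g x * hBx

theorem congr (h : IsFundamentalSystem p₂ p₁ p₀ V f g) (hV : IsOpen V) (hf : Set.EqOn f₁ f V)
    (hg : Set.EqOn g₁ g V) : IsFundamentalSystem p₂ p₁ p₀ V f₁ g₁ :=
  ⟨h.left.congr hV hf, h.right.congr hV hg, fun x hx => by
    have hx' := hV.mem_nhds hx
    rw [wronskian, hf hx, hg hx, (Filter.eventuallyEq_of_mem hx' hf).deriv_eq,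
      (Filter.eventuallyEq_of_mem hx' hg).deriv_eq]
    exact h.wronskian_ne_zero x hx⟩

theorem rescale (h : IsFundamentalSystem p₂ p₁ p₀ V f g) (m : ℂ → ℂ)
    (h₂ : ∀ x ∈ V, q₂ x = m x * p₂ x) (h₁ : ∀ x ∈ V, q₁ x = m x * p₁ x)
    (h₀ : ∀ x ∈ V, q₀ x = m x * p₀ x) : IsFundamentalSystem q₂ q₁ q₀ V f g :=
  ⟨h.left.rescale m h₂ h₁ h₀, h.right.rescale m h₂ h₁ h₀, h.wronskian_ne_zero⟩

theorem comp_affine (h : IsFundamentalSystem p₂ p₁ p₀ U f g) (hU : IsOpen U) (hV : IsOpen V)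
    {α β : ℂ} (hα : α ≠ 0) (hmaps : ∀ x ∈ V, α * x + β ∈ U) :
    IsFundamentalSystem (fun x => p₂ (α * x + β)) (fun x => α * p₁ (α * x + β))
      (fun x => α ^ 2 * p₀ (α * x + β)) V (fun x => f (α * x + β)) (fun x => g (α * x + β)) where
  left := h.left.comp_affine hU hV hmaps
  right := h.right.comp_affine hU hV hmaps
  wronskian_ne_zero x hx := by
    have hderiv (y : ℂ → ℂ) : deriv (fun x => y (α * x + β)) x = α * deriv y (α * x + β) := by
      rw [deriv_comp_mul_left α (fun t => y (t + β)), deriv_comp_add_const, smul_eq_mul]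
    have hW : wronskian (fun x => f (α * x + β)) (fun x => g (α * x + β)) x =
        α * wronskian f g (α * x + β) := by
      simp only [wronskian, hderiv]; ring
    rw [hW]
    exact mul_ne_zero hα (h.wronskian_ne_zero _ (hmaps x hx))

theorem gauge {e₁ e₂ ρ ρ' : ℂ → ℂ} (h : IsFundamentalSystem p₂ p₁ p₀ V f g) (hV : IsOpen V)
    (he₁ : ∀ x ∈ V, HasDerivAt e₁ (ρ x * e₁ x) x) (he₂ : ∀ x ∈ V, HasDerivAt e₂ (ρ x * e₂ x) x)
    (hne₁ : ∀ x ∈ V, e₁ x ≠ 0) (hne₂ : ∀ x ∈ V, e₂ x ≠ 0)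
    (hρ : ∀ x ∈ V, HasDerivAt ρ (ρ' x) x) (h₁ : ∀ x ∈ V, p₁ x = q₁ x + 2 * ρ x * p₂ x)
    (h₀ : ∀ x ∈ V, p₀ x = q₀ x + ρ x * q₁ x + (ρ' x + ρ x ^ 2) * p₂ x) :
    IsFundamentalSystem p₂ q₁ q₀ V (fun x => e₁ x * f x) (fun x => e₂ x * g x) where
  left := h.left.gauge hV he₁ hρ h₁ h₀
  right := h.right.gauge hV he₂ hρ h₁ h₀
  wronskian_ne_zero x hx := by
    have hW : wronskian (fun x => e₁ x * f x) (fun x => e₂ x * g x) x =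
        e₁ x * e₂ x * wronskian f g x := by
      rw [wronskian, ((he₁ x hx).fun_mul (h.left.hasDerivAt hV hx)).deriv,
        ((he₂ x hx).fun_mul (h.right.hasDerivAt hV hx)).deriv, wronskian]
      ring
    rw [hW]
    exact mul_ne_zero (mul_ne_zero (hne₁ x hx) (hne₂ x hx)) (h.wronskian_ne_zero x hx)

end IsFundamentalSystem

theorem hasDerivAt_of_pow_eq {e h : ℂ → ℂ} {h' x : ℂ} {m : ℕ} (hm : m ≠ 0)
    (he : ContinuousAt e x) (hpow : ∀ᶠ v in nhds x, e v ^ m = h v) (hx : h x ≠ 0)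
    (hh : HasDerivAt h h' x) : HasDerivAt e (h' / (m * h x) * e x) x := by
  have hex : e x ≠ 0 := fun h0 => hx (by rw [← hpow.self_of_nhds, h0, zero_pow hm])
  have hm' : (m : ℂ) ≠ 0 := Nat.cast_ne_zero.2 hm
  have hstrict : HasStrictDerivAt (fun z : ℂ => z ^ m) (m * e x ^ (m - 1)) (e x) :=
    hasStrictDerivAt_pow m (e x)
  have hf' : (m : ℂ) * e x ^ (m - 1) ≠ 0 := mul_ne_zero hm' (pow_ne_zero _ hex)
  have hinv := (hstrict.to_localInverse hf').hasDerivAt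
  rw [hpow.self_of_nhds] at hinv
  refine ((hinv.comp x hh).congr_of_eventuallyEq ?_).congr_deriv ?_
  · filter_upwards [hpow, he.eventually (hstrict.eventually_left_inverse hf')] with v hv hleft
    rw [Function.comp_apply, ← hv, hleft]
  · rw [← hpow.self_of_nhds]
    obtain ⟨k, rfl⟩ := Nat.exists_eq_succ_of_ne_zero hm
    rw [Nat.succ_sub_one, pow_succ]
    field_simp

theorem hasDerivAt_one_div_of_pow_eq {e h : ℂ → ℂ} {h' x : ℂ} {m : ℕ} (hm : m ≠ 0)
    (he : ContinuousAt e x) (hpow : ∀ᶠ v in nhds x, e v ^ m = h v) (hx : h x ≠ 0)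
    (hh : HasDerivAt h h' x) :
    HasDerivAt (fun v => 1 / e v) (-(h' / (m * h x)) * (1 / e x)) x := by
  have hex : e x ≠ 0 := fun h0 => hx (by rw [← hpow.self_of_nhds, h0, zero_pow hm])
  refine ((hasDerivAt_const x (1 : ℂ)).div (hasDerivAt_of_pow_eq hm he hpow hx hh)
    hex).congr_deriv ?_
  field_simp
  ring

/-! ### Complex square roots -/

theorem csqrt_sq (u : ℂ) : Complex.sqrt u ^ 2 = u := Complex.cpow_ofNat_inv_pow u 2

theorem csqrt_re_pos {u : ℂ} (hu : u ∈ Complex.slitPlane) : 0 < (Complex.sqrt u).re := by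
  rw [Complex.sqrt, Complex.cpow_inv_two_re, Real.sqrt_pos]
  rcases Complex.mem_slitPlane_iff.1 hu with hre | him
  · have := norm_nonneg u
    positivity
  · linarith [Complex.abs_re_lt_norm.2 him, neg_abs_le u.re]

theorem csqrt_ne_zero {u : ℂ} (hu : u ∈ Complex.slitPlane) : Complex.sqrt u ≠ 0 := fun h =>
  (csqrt_re_pos hu).ne' (by rw [h, Complex.zero_re])

theorem hasDerivAt_csqrt_comp {f : ℂ → ℂ} {f' x : ℂ} (hf : HasDerivAt f f' x)
    (hx : f x ∈ Complex.slitPlane) :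
    HasDerivAt (fun y => Complex.sqrt (f y)) (f' / (2 * Complex.sqrt (f x))) x := by
  refine ((Complex.hasDerivAt_sqrt hx).comp x hf).congr_deriv ?_
  rw [neg_div, Complex.cpow_neg, one_div, ← Complex.sqrt]
  ring

theorem differentiableOn_even_comp_csqrt {c : ℂ → ℂ} {U : Set ℂ} (hU : IsOpen U)
    (hc : ∀ v, v ^ 2 ∈ U → DifferentiableAt ℂ c v) (heven : ∀ v, v ^ 2 ∈ U → c (-v) = c v) :
    DifferentiableOn ℂ (fun w => c (Complex.sqrt w)) U := by
  have hne (w₀ : ℂ) (hw₀ : w₀ ∈ U) (h0 : w₀ ≠ 0) :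
      DifferentiableAt ℂ (fun w => c (Complex.sqrt w)) w₀ := by
    -- near `w₀` the branch `√w₀ √(w / w₀)` is holomorphic, and agrees with `√w` up to sign
    have hbranch : (fun w => c (Complex.sqrt w)) =ᶠ[nhds w₀]
        fun w => c (Complex.sqrt w₀ * Complex.sqrt (w / w₀)) := by
      filter_upwards [hU.mem_nhds hw₀] with w hw
      have hsq : Complex.sqrt w ^ 2 = (Complex.sqrt w₀ * Complex.sqrt (w / w₀)) ^ 2 := by
        rw [mul_pow, csqrt_sq, csqrt_sq, csqrt_sq, mul_div_cancel₀ _ h0]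
      rcases sq_eq_sq_iff_eq_or_eq_neg.1 hsq with h | h
      · rw [h]
      · rw [h, heven _ (by rwa [← hsq, csqrt_sq])]
    refine DifferentiableAt.congr_of_eventuallyEq ?_ hbranch
    refine DifferentiableAt.comp (g := c) w₀ (hc _ ?_) ?_
    · rwa [div_self h0, Complex.sqrt_one, mul_one, csqrt_sq]
    · exact (hasDerivAt_csqrt_comp ((hasDerivAt_id' w₀).div_const w₀)
        (by simp [div_self h0])).differentiableAt.const_mul _
  intro w₀ hw₀
  rcases eq_or_ne w₀ 0 with rfl | h0
  · refine (Complex.differentiableOn_compl_singleton_and_continuousAt_iff (hU.mem_nhds hw₀)).1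
      ⟨fun w hw => (hne w hw.1 hw.2).differentiableWithinAt, ?_⟩ 0 hw₀
    exact ContinuousAt.comp (g := c) (hc _ (by rwa [csqrt_sq])).continuousAt
      (Complex.continuousAt_sqrt (by simp))
  · exact (hne w₀ hw₀ h0).differentiableWithinAt

/-! ### The hypergeometric equation -/

theorem isOpen_hypergeometricDomain : IsOpen hypergeometricDomain :=
  Complex.isOpen_slitPlane.preimage (continuous_const.sub continuous_id)

theorem zero_mem_hypergeometricDomain : (0 : ℂ) ∈ hypergeometricDomain := by
  simp [hypergeometricDomain]

theorem ball_subset_hypergeometricDomain : Metric.ball (0 : ℂ) 1 ⊆ hypergeometricDomain := by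
  intro w hw
  rw [hypergeometricDomain, Set.mem_ofPred_eq, sub_eq_add_neg]
  exact Complex.mem_slitPlane_of_norm_lt_one (by simpa using hw)

/-- `f` is a holomorphic solution of Gauss's equation
`w (1 - w) f'' + (c - (a + b + 1) w) f' - a b f = 0` on the plane cut along `[1, ∞)`. -/
def IsHypergeometricSolution (a b c : ℂ) (f : ℂ → ℂ) : Prop :=
  IsLinearODESolution (fun w => w * (1 - w)) (fun w => c - (a + b + 1) * w) (fun _ => -(a * b))
    hypergeometricDomain f

namespace IsHypergeometricSolution

variable {a b c : ℂ} {f : ℂ → ℂ}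

protected theorem deriv (h : IsHypergeometricSolution a b c f) :
    IsHypergeometricSolution (a + 1) (b + 1) (c + 1) (deriv f) := by
  refine (IsLinearODESolution.deriv h isOpen_hypergeometricDomain (p₂' := fun w => 1 - 2 * w)
    (p₁' := fun _ => -(a + b + 1)) (fun w _ => ?_) (fun w _ => ?_)).rescale (fun _ => 1)
    (fun w _ => ?_) (fun w _ => ?_) (fun w _ => ?_)
  · exact ((hasDerivAt_id' w).mul ((hasDerivAt_id' w).const_sub 1)).congr_deriv (by ring)
  · exact (((hasDerivAt_id' w).const_mul (a + b + 1)).const_sub c).congr_deriv (by ring)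
  all_goals ring

protected theorem iteratedDeriv (h : IsHypergeometricSolution a b c f) (k : ℕ) :
    IsHypergeometricSolution (a + k) (b + k) (c + k) (iteratedDeriv k f) := by
  induction k with
  | zero => simpa using h
  | succ k ih =>
    rw [iteratedDeriv_succ]
    simpa [add_assoc] using ih.deriv

theorem iteratedDeriv_succ_zero (h : IsHypergeometricSolution a b c f) (k : ℕ) :
    (c + k) * iteratedDeriv (k + 1) f 0 =
      (a + k) * (b + k) * iteratedDeriv k f 0 := by
  have hode := (h.iteratedDeriv k).2 0 zero_mem_hypergeometricDomain
  rw [iteratedDeriv_succ]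
  linear_combination hode

theorem taylorCoefficient_eq (h : IsHypergeometricSolution a b c f) (hf0 : f 0 = 1)
    (hc : ∀ k : ℕ, c + k ≠ 0) (k : ℕ) :
    (k.factorial : ℂ)⁻¹ * iteratedDeriv k f 0 =
      ordinaryHypergeometricCoefficient a b c k := by
  induction k with
  | zero => simp [hf0, ordinaryHypergeometricCoefficient]
  | succ k ih =>
    have hstep : iteratedDeriv (k + 1) f 0 =
        (a + k) * (b + k) / (c + k) * iteratedDeriv k f 0 := by
      rw [div_mul_eq_mul_div, eq_div_iff (hc k), ← h.iteratedDeriv_succ_zero k, mul_comm]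
    rw [hstep, Nat.factorial_succ, Nat.cast_mul, mul_inv]
    trans ((k + 1 : ℕ) : ℂ)⁻¹ * ((a + k) * (b + k) / (c + k)) *
      ordinaryHypergeometricCoefficient a b c k
    · rw [← ih]; ring
    · simp only [ordinaryHypergeometricCoefficient, ascPochhammer_succ_eval, Nat.factorial_succ,
        Nat.cast_mul, mul_inv]
      ring

theorem hypergeometricF_eq (h : IsHypergeometricSolution a b c f) (hf0 : f 0 = 1)
    (hc : ∀ k : ℕ, c + k ≠ 0) : Set.EqOn (hypergeometricF a b c) f hypergeometricDomain := by
  refine fun w hw => hypergeometricF_eq_of_continuation ⟨h.1, fun v hv => ?_⟩ hw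
  have htaylor := Complex.hasSum_taylorSeries_on_ball
    (h.1.mono ball_subset_hypergeometricDomain) hv
  rw [ordinaryHypergeometric_eq_tsum, ← htaylor.tsum_eq]
  refine tsum_congr fun k => ?_
  have hk := h.taylorCoefficient_eq hf0 hc k
  rw [ordinaryHypergeometricCoefficient] at hk
  simp only [smul_eq_mul, sub_zero, ← hk]
  ring

theorem eulerTransform (h : IsHypergeometricSolution a b c f) :
    IsHypergeometricSolution (c - a) (c - b) c (fun w => (1 - w) ^ (a + b - c) * f w) := by
  have hsub (w : ℂ) : HasDerivAt (fun w => 1 - w) (-1) w := (hasDerivAt_id' w).const_sub 1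
  have hne (w : ℂ) (hw : w ∈ hypergeometricDomain) : 1 - w ≠ 0 := Complex.slitPlane_ne_zero hw
  refine IsLinearODESolution.gauge h isOpen_hypergeometricDomain
    (ρ := fun w => -(a + b - c) / (1 - w)) (ρ' := fun w => -(a + b - c) / (1 - w) ^ 2)
    (fun w hw => ?_) (fun w hw => ?_) (fun w hw => ?_) (fun w hw => ?_) <;> have := hne w hw
  · refine ((hsub w).cpow_const hw).congr_deriv ?_
    rw [Complex.cpow_sub _ _ (hne w hw), Complex.cpow_one]
    ring
  · refine ((hasDerivAt_const w (-(a + b - c))).div (hsub w) (hne w hw)).congr_deriv ?_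
    ring
  · field_simp
    ring
  · field_simp
    ring

end IsHypergeometricSolution

/-! ### Elementary cases of Gauss's function -/

/-- The principal branch of the inverse sine, holomorphic where `1 - v ^ 2` avoids `(-∞, 0]`. -/
noncomputable def complexArcsin (v : ℂ) : ℂ :=
  -Complex.I * Complex.log (Complex.sqrt (1 - v ^ 2) + Complex.I * v)

/-- `cos (2s arcsin √w)`, which is `F(s, -s; 1/2; w)`. -/
noncomputable def cosArcsinSqrt (s w : ℂ) : ℂ :=
  Complex.cos (2 * s * complexArcsin (Complex.sqrt w))

theorem mem_slitPlane_of_mul_eq_one {x y : ℂ} (h : x * y = 1) (hre : 0 < (x + y).re) :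
    x ∈ Complex.slitPlane := by
  by_contra hx
  obtain ⟨hxre, hxim⟩ := not_or.1 (Complex.mem_slitPlane_iff.not.1 hx)
  have hprod := congrArg Complex.re h
  rw [Complex.mul_re, not_not.1 hxim, zero_mul, sub_zero, Complex.one_re] at hprod
  rw [Complex.add_re] at hre
  nlinarith

theorem sqrt_add_I_mul_mul_sqrt_sub_I_mul (v : ℂ) :
    (Complex.sqrt (1 - v ^ 2) + Complex.I * v) *
      (Complex.sqrt (1 - v ^ 2) - Complex.I * v) = 1 := by
  linear_combination csqrt_sq (1 - v ^ 2) - v ^ 2 * Complex.I_sq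

theorem hasDerivAt_sqrt_one_sub {w : ℂ} (hw : w ∈ hypergeometricDomain) :
    HasDerivAt (fun w => Complex.sqrt (1 - w)) (-1 / (2 * Complex.sqrt (1 - w))) w :=
  hasDerivAt_csqrt_comp ((hasDerivAt_id' w).const_sub 1) hw

section Arcsin

variable {v : ℂ} (hv : v ^ 2 ∈ hypergeometricDomain)
include hv

theorem sqrt_add_I_mul_mem_slitPlane :
    Complex.sqrt (1 - v ^ 2) + Complex.I * v ∈ Complex.slitPlane := by
  refine mem_slitPlane_of_mul_eq_one (sqrt_add_I_mul_mul_sqrt_sub_I_mul v) ?_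
  have hre := csqrt_re_pos hv
  rw [add_add_sub_cancel, Complex.add_re]
  exact add_pos hre hre

theorem hasDerivAt_sqrt_one_sub_sq :
    HasDerivAt (fun v => Complex.sqrt (1 - v ^ 2)) (-v / Complex.sqrt (1 - v ^ 2)) v := by
  refine ((hasDerivAt_sqrt_one_sub hv).comp v (hasDerivAt_pow 2 v)).congr_deriv ?_
  have := csqrt_ne_zero hv
  field_simp
  simp

theorem hasDerivAt_complexArcsin :
    HasDerivAt complexArcsin (1 / Complex.sqrt (1 - v ^ 2)) v := by
  have hm := sqrt_add_I_mul_mem_slitPlane hv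
  have hm0 := Complex.slitPlane_ne_zero hm
  have hq := csqrt_ne_zero hv
  refine ((((hasDerivAt_sqrt_one_sub_sq hv).add
    ((hasDerivAt_id' v).const_mul Complex.I)).clog hm).const_mul (-Complex.I)).congr_deriv ?_
  simp only [Pi.add_apply]
  field_simp
  linear_combination (-Complex.sqrt (1 - v ^ 2)) * Complex.I_sq

theorem complexArcsin_neg : complexArcsin (-v) = -complexArcsin v := by
  have hm := sqrt_add_I_mul_mem_slitPlane hv
  have hinv : Complex.sqrt (1 - v ^ 2) + Complex.I * -v =
      (Complex.sqrt (1 - v ^ 2) + Complex.I * v)⁻¹ := by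
    rw [mul_neg, ← sub_eq_add_neg]
    exact eq_inv_of_mul_eq_one_right (sqrt_add_I_mul_mul_sqrt_sub_I_mul v)
  rw [complexArcsin, neg_sq, hinv, Complex.log_inv _ (Complex.slitPlane_arg_ne_pi hm),
    complexArcsin, mul_neg]

theorem cos_mul_complexArcsin_neg (t : ℂ) :
    Complex.cos (t * complexArcsin (-v)) = Complex.cos (t * complexArcsin v) := by
  rw [complexArcsin_neg hv, mul_neg, Complex.cos_neg]

theorem cosArcsinSqrt_sq (s : ℂ) :
    cosArcsinSqrt s (v ^ 2) = Complex.cos (2 * s * complexArcsin v) := by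
  rw [cosArcsinSqrt]
  rcases sq_eq_sq_iff_eq_or_eq_neg.1 (csqrt_sq (v ^ 2)) with h | h <;> rw [h]
  exact cos_mul_complexArcsin_neg hv _

end Arcsin

theorem add_natCast_ne_zero_of_re_pos {c : ℂ} (hc : 0 < c.re) (k : ℕ) : c + k ≠ 0 := fun h => by
  have hre := congrArg Complex.re h
  rw [Complex.add_re, Complex.natCast_re, Complex.zero_re] at hre
  exact (add_pos_of_pos_of_nonneg hc k.cast_nonneg).ne' hre

section CosArcsinSqrt

variable (s : ℂ) {v w : ℂ}

theorem differentiableOn_cosArcsinSqrt :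
    DifferentiableOn ℂ (cosArcsinSqrt s) hypergeometricDomain :=
  differentiableOn_even_comp_csqrt isOpen_hypergeometricDomain
    (c := fun v => Complex.cos (2 * s * complexArcsin v))
    (fun _ hv => ((hasDerivAt_complexArcsin hv).const_mul (2 * s)).ccos.differentiableAt)
    (fun _ hv => cos_mul_complexArcsin_neg hv _)

theorem mul_sqrt_mul_deriv_cosArcsinSqrt_sq (hv : v ^ 2 ∈ hypergeometricDomain) :
    v * Complex.sqrt (1 - v ^ 2) * deriv (cosArcsinSqrt s) (v ^ 2) =
      -s * Complex.sin (2 * s * complexArcsin v) := by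
  have hmem : (fun v : ℂ => v ^ 2) ⁻¹' hypergeometricDomain ∈ nhds v :=
    (continuous_pow 2).continuousAt.preimage_mem_nhds (isOpen_hypergeometricDomain.mem_nhds hv)
  have hcomp := ((differentiableOn_cosArcsinSqrt s).differentiableAt
    (isOpen_hypergeometricDomain.mem_nhds hv)).hasDerivAt.comp v (hasDerivAt_pow 2 v)
  have hcos := ((hasDerivAt_complexArcsin hv).const_mul (2 * s)).ccos.congr_of_eventuallyEq
    (Filter.eventuallyEq_of_mem hmem fun u hu => cosArcsinSqrt_sq hu s)
  have hchain := hcomp.unique hcos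
  have hq := csqrt_ne_zero hv
  field_simp at hchain
  push_cast at hchain
  linear_combination hchain / 2

theorem isHypergeometricSolution_cosArcsinSqrt :
    IsHypergeometricSolution s (-s) (1 / 2) (cosArcsinSqrt s) := by
  refine ⟨differentiableOn_cosArcsinSqrt s, fun w hw => ?_⟩
  obtain ⟨v, rfl⟩ : ∃ v : ℂ, v ^ 2 = w := ⟨_, csqrt_sq w⟩
  have hmem : (fun v : ℂ => v ^ 2) ⁻¹' hypergeometricDomain ∈ nhds v :=
    (continuous_pow 2).continuousAt.preimage_mem_nhds (isOpen_hypergeometricDomain.mem_nhds hw)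
  have hC' := (((differentiableOn_cosArcsinSqrt s).deriv
    isOpen_hypergeometricDomain).differentiableAt
      (isOpen_hypergeometricDomain.mem_nhds hw)).hasDerivAt.comp v (hasDerivAt_pow 2 v)
  have hlhs := ((hasDerivAt_id' v).mul (hasDerivAt_sqrt_one_sub_sq hw)).mul hC'
  have hrhs := (((hasDerivAt_complexArcsin hw).const_mul (2 * s)).csin.const_mul
    (-s)).congr_of_eventuallyEq (Filter.eventuallyEq_of_mem hmem fun u hu =>
      mul_sqrt_mul_deriv_cosArcsinSqrt_sq s hu)
  have hode := hlhs.unique hrhs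
  have hq := csqrt_ne_zero hw
  have hqq := csqrt_sq (1 - v ^ 2)
  rw [← cosArcsinSqrt_sq hw] at hode
  simp only [Pi.mul_apply, Function.comp_apply] at hode
  field_simp at hode
  push_cast at hode
  rw [hqq] at hode
  linear_combination hode / 2

theorem cosArcsinSqrt_first_integral (hw : w ∈ hypergeometricDomain) :
    s ^ 2 * cosArcsinSqrt s w ^ 2 + w * (1 - w) * deriv (cosArcsinSqrt s) w ^ 2 = s ^ 2 := by
  obtain ⟨v, rfl⟩ : ∃ v : ℂ, v ^ 2 = w := ⟨_, csqrt_sq w⟩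
  have hsin := congrArg (· ^ 2) (mul_sqrt_mul_deriv_cosArcsinSqrt_sq s hw)
  simp only [mul_pow, csqrt_sq] at hsin
  rw [cosArcsinSqrt_sq hw]
  linear_combination hsin + s ^ 2 * Complex.sin_sq_add_cos_sq (2 * s * complexArcsin v)

theorem cosArcsinSqrt_zero : cosArcsinSqrt s 0 = 1 := by
  simp [cosArcsinSqrt, complexArcsin]

theorem deriv_cosArcsinSqrt_zero : deriv (cosArcsinSqrt s) 0 = -2 * s ^ 2 := by
  have hode := (isHypergeometricSolution_cosArcsinSqrt s).2 0 zero_mem_hypergeometricDomain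
  rw [cosArcsinSqrt_zero] at hode
  linear_combination 2 * hode

theorem hypergeometricF_half_sub_half_add_half :
    Set.EqOn (hypergeometricF (1 / 2 - s) (1 / 2 + s) (1 / 2))
      (fun w => (Complex.sqrt (1 - w))⁻¹ * cosArcsinSqrt s w) hypergeometricDomain := by
  refine IsHypergeometricSolution.hypergeometricF_eq ?_ (by simp [cosArcsinSqrt_zero])
    (add_natCast_ne_zero_of_re_pos (by norm_num))
  convert (isHypergeometricSolution_cosArcsinSqrt s).eulerTransform using 3 with w
  · ring
  · rw [Complex.sqrt, ← Complex.cpow_neg]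
    ring_nf

theorem hypergeometricF_half_sub_half_add_three_halves (hs : s ≠ 0) :
    Set.EqOn (hypergeometricF (1 / 2 - s) (1 / 2 + s) (3 / 2))
      (fun w => -1 / (2 * s ^ 2) * (Complex.sqrt (1 - w) * deriv (cosArcsinSqrt s) w))
      hypergeometricDomain := by
  have heuler : IsHypergeometricSolution (1 / 2 - s) (1 / 2 + s) (3 / 2)
      (fun w => Complex.sqrt (1 - w) * deriv (cosArcsinSqrt s) w) := by
    convert (isHypergeometricSolution_cosArcsinSqrt s).deriv.eulerTransform using 1
    · ring
    · ring
    · norm_num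
    · funext w
      rw [Complex.sqrt]
      ring_nf
  refine IsHypergeometricSolution.hypergeometricF_eq
    (IsLinearODESolution.const_mul heuler isOpen_hypergeometricDomain _) ?_
    (add_natCast_ne_zero_of_re_pos (by norm_num))
  rw [deriv_cosArcsinSqrt_zero, sub_zero, Complex.sqrt_one]
  field_simp

end CosArcsinSqrt

/-- `((1 + √(1 - w)) / 2) ^ (-s)`, which is `F((s+1)/2, s/2; s+1; w)`. -/
noncomputable def sqrtMeanPow (s w : ℂ) : ℂ := ((1 + Complex.sqrt (1 - w)) / 2) ^ (-s)

section SqrtMeanPow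

variable (s : ℂ) {w : ℂ}

theorem one_add_sqrt_one_sub_mem_slitPlane (hw : w ∈ hypergeometricDomain) :
    (1 + Complex.sqrt (1 - w)) / 2 ∈ Complex.slitPlane := by
  left
  have hre := csqrt_re_pos hw
  rw [Complex.div_ofNat_re, Complex.add_re, Complex.one_re]
  positivity

theorem hasDerivAt_sqrtMeanPow (hw : w ∈ hypergeometricDomain) :
    HasDerivAt (sqrtMeanPow s)
      (s / (2 * Complex.sqrt (1 - w) * (1 + Complex.sqrt (1 - w))) * sqrtMeanPow s w) w := by
  have hm := one_add_sqrt_one_sub_mem_slitPlane hw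
  have hm0 := Complex.slitPlane_ne_zero hm
  have hq := csqrt_ne_zero hw
  have hq1 : 1 + Complex.sqrt (1 - w) ≠ 0 := fun h => hm0 (by rw [h, zero_div])
  refine ((((hasDerivAt_sqrt_one_sub hw).const_add 1).div_const 2).cpow_const
    (c := -s) hm).congr_deriv ?_
  rw [Complex.cpow_sub _ _ hm0, Complex.cpow_one, ← sqrtMeanPow]
  field_simp

theorem isHypergeometricSolution_sqrtMeanPow :
    IsHypergeometricSolution ((s + 1) / 2) (s / 2) (s + 1) (sqrtMeanPow s) := by
  have hne (w : ℂ) (hw : w ∈ hypergeometricDomain) :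
      Complex.sqrt (1 - w) ≠ 0 ∧ 1 + Complex.sqrt (1 - w) ≠ 0 :=
    ⟨csqrt_ne_zero hw, fun h => Complex.slitPlane_ne_zero
      (one_add_sqrt_one_sub_mem_slitPlane hw) (by rw [h, zero_div])⟩
  refine IsLinearODESolution.of_hasDerivAt isOpen_hypergeometricDomain
    (fun w hw => hasDerivAt_sqrtMeanPow s hw) (y'' := fun w =>
      s * (1 + (2 + s) * Complex.sqrt (1 - w)) / (4 * Complex.sqrt (1 - w) ^ 3 *
        (1 + Complex.sqrt (1 - w)) ^ 2) * sqrtMeanPow s w)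
    (fun w hw => ?_) (fun w hw => ?_) <;> obtain ⟨hq, hq1⟩ := hne w hw
  · refine (((hasDerivAt_const w s).fun_div (((hasDerivAt_sqrt_one_sub hw).const_mul 2).fun_mul
      ((hasDerivAt_sqrt_one_sub hw).const_add 1))
      (mul_ne_zero (mul_ne_zero two_ne_zero hq) hq1)).fun_mul
      (hasDerivAt_sqrtMeanPow s hw)).congr_deriv ?_
    field_simp
    ring
  · have hw' : w = 1 - Complex.sqrt (1 - w) ^ 2 := by rw [csqrt_sq]; ring
    generalize sqrtMeanPow s w = h
    generalize Complex.sqrt (1 - w) = q at *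
    subst hw'
    field_simp
    ring

theorem hypergeometricF_half_succ_half_add_two (hs : 0 < s.re) :
    Set.EqOn (hypergeometricF ((s + 1) / 2) ((s + 2) / 2) (s + 1))
      (fun w => (Complex.sqrt (1 - w))⁻¹ * sqrtMeanPow s w) hypergeometricDomain := by
  refine IsHypergeometricSolution.hypergeometricF_eq ?_ (by simp [sqrtMeanPow])
    (add_natCast_ne_zero_of_re_pos (by simpa using add_pos hs one_pos))
  convert (isHypergeometricSolution_sqrtMeanPow s).eulerTransform using 3 with w
  · ring
  · ring
  · rw [Complex.sqrt, ← Complex.cpow_neg]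
    ring_nf

end SqrtMeanPow

/-! ### The cut planes -/

theorem mem_slitPlane_of_forall_ne {u : ℂ} (h : ∀ t : ℝ, 0 ≤ t → u ≠ -(t : ℂ)) :
    u ∈ Complex.slitPlane := by
  by_contra hu
  obtain ⟨hre, him⟩ := not_or.1 (Complex.mem_slitPlane_iff.not.1 hu)
  exact h (-u.re) (by linarith) (Complex.ext (by simp) (by simpa using him))

theorem ne_neg_ofReal_of_mem_slitPlane {u : ℂ} (hu : u ∈ Complex.slitPlane) {t : ℝ} (ht : 0 ≤ t) :
    u ≠ -(t : ℂ) := by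
  rintro rfl
  rw [Complex.mem_slitPlane_iff] at hu
  simp only [Complex.neg_re, Complex.ofReal_re, Complex.neg_im, Complex.ofReal_im, neg_zero,
    ne_eq, not_true_eq_false, or_false] at hu
  linarith

theorem one_sub_div_two_mem_hypergeometricDomain {z : ℂ} (hz : 1 + z ∈ Complex.slitPlane) :
    (1 - z) / 2 ∈ hypergeometricDomain := by
  refine mem_slitPlane_of_forall_ne fun t ht h =>
    ne_neg_ofReal_of_mem_slitPlane hz (mul_nonneg zero_le_two ht) ?_
  push_cast
  linear_combination 2 * h

theorem isOpen_legendreDomain : IsOpen legendreDomain :=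
  Complex.isOpen_slitPlane.preimage (continuous_id.sub continuous_const)

theorem isOpen_ferrersDomain : IsOpen ferrersDomain :=
  (Complex.isOpen_slitPlane.preimage (continuous_const.sub continuous_id)).inter
    (Complex.isOpen_slitPlane.preimage (continuous_const.add continuous_id))

section LegendreDomain

variable {z : ℂ} (hz : z ∈ legendreDomain)
include hz

theorem add_ofReal_mem_slitPlane {t : ℝ} (ht : -1 ≤ t) : z + t ∈ Complex.slitPlane := by
  rw [legendreDomain, Set.mem_ofPred_eq, Complex.mem_slitPlane_iff, Complex.sub_re,
    Complex.one_re, Complex.sub_im, Complex.one_im, sub_zero] at hz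
  rw [Complex.mem_slitPlane_iff, Complex.add_re, Complex.ofReal_re, Complex.add_im,
    Complex.ofReal_im, add_zero]
  exact hz.imp_left fun h => by linarith

theorem mem_slitPlane_of_mem_legendreDomain : z ∈ Complex.slitPlane := by
  simpa using add_ofReal_mem_slitPlane hz (t := 0) (by norm_num)

theorem one_add_mem_slitPlane_of_mem_legendreDomain : 1 + z ∈ Complex.slitPlane := by
  simpa [add_comm] using add_ofReal_mem_slitPlane hz (t := 1) (by norm_num)

theorem add_one_div_sub_one_mem_slitPlane : (z + 1) / (z - 1) ∈ Complex.slitPlane := by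
  have hne : z - 1 ≠ 0 := Complex.slitPlane_ne_zero hz
  refine mem_slitPlane_of_forall_ne fun t ht h =>
    ne_neg_ofReal_of_mem_slitPlane hz (t := 2 / (1 + t)) (by positivity) ?_
  have ht' : (1 + (t : ℂ)) ≠ 0 := by exact_mod_cast (by positivity : 1 + t ≠ 0)
  push_cast
  field_simp at h ⊢
  linear_combination h

theorem one_div_sq_mem_hypergeometricDomain : 1 / z ^ 2 ∈ hypergeometricDomain := by
  have hz0 := Complex.slitPlane_ne_zero (mem_slitPlane_of_mem_legendreDomain hz)
  refine mem_slitPlane_of_forall_ne fun t ht h => ?_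
  have hsq : z ^ 2 = ((1 / √(1 + t) : ℝ) : ℂ) ^ 2 := by
    have ht' : (1 + (t : ℂ)) ≠ 0 := by exact_mod_cast (by positivity : 1 + t ≠ 0)
    rw [← Complex.ofReal_pow, div_pow, Real.sq_sqrt (by positivity)]
    push_cast
    field_simp at h ⊢
    linear_combination h
  have hle : 1 / √(1 + t) ≤ 1 := by
    rw [div_le_one (by positivity)]
    exact Real.one_le_sqrt.2 (by linarith)
  have hpos : 0 < 1 / √(1 + t) := by positivity
  rcases sq_eq_sq_iff_eq_or_eq_neg.1 hsq with rfl | rfl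
  · refine ne_neg_ofReal_of_mem_slitPlane hz (t := 1 - 1 / √(1 + t)) (by linarith) ?_
    push_cast
    ring
  · exact ne_neg_ofReal_of_mem_slitPlane (mem_slitPlane_of_mem_legendreDomain hz) hpos.le rfl

end LegendreDomain

theorem one_add_div_one_sub_mem_slitPlane {z : ℂ} (hz : z ∈ ferrersDomain) :
    (1 + z) / (1 - z) ∈ Complex.slitPlane := by
  have hne := Complex.slitPlane_ne_zero hz.1
  refine mem_slitPlane_of_forall_ne fun t ht h => ?_
  have hmul : z * (1 - t) = -(1 + t) := by
    field_simp at h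
    linear_combination h
  rcases lt_trichotomy t 1 with h1 | rfl | h1
  · refine ne_neg_ofReal_of_mem_slitPlane hz.2 (t := 2 * t / (1 - t))
      (div_nonneg (by positivity) (by linarith)) ?_
    have ht' : (1 - (t : ℂ)) ≠ 0 := by exact_mod_cast (by linarith : 0 < 1 - t).ne'
    push_cast
    field_simp
    linear_combination hmul
  · norm_num at hmul
  · refine ne_neg_ofReal_of_mem_slitPlane hz.1 (t := 2 / (t - 1))
      (div_nonneg zero_le_two (by linarith)) ?_
    have ht' : ((t : ℂ) - 1) ≠ 0 := by exact_mod_cast (by linarith : 0 < t - 1).ne'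
    push_cast
    field_simp
    linear_combination hmul

/-! ### Chebyshev's equation -/

/-- `u` is a holomorphic solution on `U` of Chebyshev's equation
`(1 - z²) u'' - z u' + s² u = 0`. -/
def IsChebyshevSolution (s : ℂ) (U : Set ℂ) (u : ℂ → ℂ) : Prop :=
  IsLinearODESolution (fun z => 1 - z ^ 2) (fun z => -z) (fun _ => s ^ 2) U u

/-- `u` and `v` are linearly independent solutions on `U` of Chebyshev's equation
`(1 - z²) y'' - z y' + s² y = 0`. -/
def IsChebyshevSystem (s : ℂ) (U : Set ℂ) (u v : ℂ → ℂ) : Prop :=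
  IsFundamentalSystem (fun z => 1 - z ^ 2) (fun z => -z) (fun _ => s ^ 2) U u v

/-- The function `cos (2s arcsin √((1 - z) / 2))`, that is `cos (s arccos z)`, which for a natural
number `s` is the Chebyshev polynomial `T_s`. -/
noncomputable def chebyshevCos (s z : ℂ) : ℂ := cosArcsinSqrt s ((1 - z) / 2)

section ChebyshevCos

variable (s : ℂ) {U : Set ℂ} {z : ℂ}

theorem hasDerivAt_chebyshevCos (hz : (1 - z) / 2 ∈ hypergeometricDomain) :
    HasDerivAt (chebyshevCos s) (-(deriv (cosArcsinSqrt s) ((1 - z) / 2) / 2)) z := by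
  refine (HasDerivAt.comp (h₂ := cosArcsinSqrt s) z
    (((differentiableOn_cosArcsinSqrt s).differentiableAt
      (isOpen_hypergeometricDomain.mem_nhds hz)).hasDerivAt)
    (((hasDerivAt_id' z).const_sub 1).div_const 2)).congr_deriv ?_
  ring

theorem isChebyshevSolution_chebyshevCos (hU : IsOpen U)
    (hmaps : ∀ z ∈ U, (1 - z) / 2 ∈ hypergeometricDomain) :
    IsChebyshevSolution s U (chebyshevCos s) := by
  have haffine (z : ℂ) : -1 / 2 * z + 1 / 2 = (1 - z) / 2 := by ring
  have hcomp := (IsLinearODESolution.comp_affine (isHypergeometricSolution_cosArcsinSqrt s)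
    isOpen_hypergeometricDomain hU (α := -1 / 2) (β := 1 / 2)
    (fun z hz => by rw [haffine]; exact hmaps z hz)).rescale (q₂ := fun z => 1 - z ^ 2)
    (q₁ := fun z => -z) (q₀ := fun _ => s ^ 2) (fun _ => 4) (fun z _ => by ring)
    (fun z _ => by ring) (fun z _ => by ring)
  exact hcomp.congr hU fun z _ => congrArg (cosArcsinSqrt s) (haffine z).symm

theorem chebyshevCos_first_integral (hz : (1 - z) / 2 ∈ hypergeometricDomain) :
    s ^ 2 * chebyshevCos s z ^ 2 + (1 - z ^ 2) * deriv (chebyshevCos s) z ^ 2 = s ^ 2 := by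
  rw [(hasDerivAt_chebyshevCos s hz).deriv, chebyshevCos]
  linear_combination cosArcsinSqrt_first_integral s hz

end ChebyshevCos

/-- The branch of `√(z² - 1)` on the plane cut along `(-∞, 1]` that is positive for `z > 1`. -/
noncomputable def sqrtSqSubOne (z : ℂ) : ℂ := z * Complex.sqrt (1 - 1 / z ^ 2)

/-- The function `((z + √(z² - 1)) / 2) ^ (-s)` on the plane cut along `(-∞, 1]`. -/
noncomputable def chebyshevExp (s z : ℂ) : ℂ := z ^ (-s) * sqrtMeanPow s (1 / z ^ 2)

section ChebyshevExp

variable (s : ℂ) {z : ℂ} (hz : z ∈ legendreDomain)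
include hz

theorem sqrtSqSubOne_sq : sqrtSqSubOne z ^ 2 = z ^ 2 - 1 := by
  have hz0 := Complex.slitPlane_ne_zero (mem_slitPlane_of_mem_legendreDomain hz)
  rw [sqrtSqSubOne, mul_pow, csqrt_sq]
  field_simp

theorem sqrtSqSubOne_ne_zero : sqrtSqSubOne z ≠ 0 :=
  mul_ne_zero (Complex.slitPlane_ne_zero (mem_slitPlane_of_mem_legendreDomain hz))
    (csqrt_ne_zero (one_div_sq_mem_hypergeometricDomain hz))

theorem hasDerivAt_one_div_sq : HasDerivAt (fun z : ℂ => 1 / z ^ 2) (-2 / z ^ 3) z := by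
  have hz0 := Complex.slitPlane_ne_zero (mem_slitPlane_of_mem_legendreDomain hz)
  refine ((hasDerivAt_const z (1 : ℂ)).div (hasDerivAt_pow 2 z) (pow_ne_zero 2 hz0)).congr_deriv ?_
  push_cast
  field_simp
  ring

theorem hasDerivAt_sqrtSqSubOne : HasDerivAt sqrtSqSubOne (z / sqrtSqSubOne z) z := by
  have hz0 := Complex.slitPlane_ne_zero (mem_slitPlane_of_mem_legendreDomain hz)
  have hw := one_div_sq_mem_hypergeometricDomain hz
  have hq := csqrt_ne_zero hw
  have hq2 := csqrt_sq (1 - 1 / z ^ 2)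
  refine ((hasDerivAt_id' z).mul
    (hasDerivAt_csqrt_comp ((hasDerivAt_one_div_sq hz).const_sub 1) hw)).congr_deriv ?_
  unfold sqrtSqSubOne
  generalize Complex.sqrt (1 - 1 / z ^ 2) = q at *
  field_simp at hq2 ⊢
  linear_combination hq2

theorem chebyshevExp_ne_zero : chebyshevExp s z ≠ 0 := by
  have hz0 := Complex.slitPlane_ne_zero (mem_slitPlane_of_mem_legendreDomain hz)
  have hm0 := Complex.slitPlane_ne_zero
    (one_add_sqrt_one_sub_mem_slitPlane (one_div_sq_mem_hypergeometricDomain hz))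
  exact mul_ne_zero (fun h => hz0 (Complex.cpow_eq_zero_iff _ _ |>.1 h).1)
    (fun h => hm0 (Complex.cpow_eq_zero_iff _ _ |>.1 h).1)

theorem hasDerivAt_chebyshevExp :
    HasDerivAt (chebyshevExp s) (-s * chebyshevExp s z / sqrtSqSubOne z) z := by
  have hzs := mem_slitPlane_of_mem_legendreDomain hz
  have hz0 := Complex.slitPlane_ne_zero hzs
  have hw := one_div_sq_mem_hypergeometricDomain hz
  have hq := csqrt_ne_zero hw
  have hq2 := csqrt_sq (1 - 1 / z ^ 2)
  have hq1 : 1 + Complex.sqrt (1 - 1 / z ^ 2) ≠ 0 := fun h =>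
    Complex.slitPlane_ne_zero (one_add_sqrt_one_sub_mem_slitPlane hw) (by rw [h, zero_div])
  refine (((hasDerivAt_id' z).cpow_const (c := -s) hzs).mul
    ((hasDerivAt_sqrtMeanPow s hw).comp z (hasDerivAt_one_div_sq hz))).congr_deriv ?_
  rw [Complex.cpow_sub _ _ hz0, Complex.cpow_one]
  unfold chebyshevExp sqrtSqSubOne
  simp only [Function.comp_apply]
  generalize Complex.sqrt (1 - 1 / z ^ 2) = q at *
  field_simp at hq2 ⊢
  linear_combination -s * z ^ (-s) * sqrtMeanPow s (1 / z ^ 2) * hq2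

end ChebyshevExp

theorem isChebyshevSolution_chebyshevExp (s : ℂ) :
    IsChebyshevSolution s legendreDomain (chebyshevExp s) := by
  refine IsLinearODESolution.of_hasDerivAt isOpen_legendreDomain
    (fun z hz => hasDerivAt_chebyshevExp s hz)
    (fun z hz => ((hasDerivAt_chebyshevExp s hz).const_mul (-s)).div (hasDerivAt_sqrtSqSubOne hz)
      (sqrtSqSubOne_ne_zero hz)) fun z hz => ?_
  have hm := sqrtSqSubOne_ne_zero hz
  rw [show 1 - z ^ 2 = -sqrtSqSubOne z ^ 2 by rw [sqrtSqSubOne_sq hz]; ring]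
  field_simp
  ring

theorem isChebyshevSystem_legendreDomain {s : ℂ} (hs : s ≠ 0) :
    IsChebyshevSystem s legendreDomain (chebyshevCos s) (chebyshevExp s) where
  left := isChebyshevSolution_chebyshevCos s isOpen_legendreDomain fun _ hz =>
    one_sub_div_two_mem_hypergeometricDomain (one_add_mem_slitPlane_of_mem_legendreDomain hz)
  right := isChebyshevSolution_chebyshevExp s
  wronskian_ne_zero z hz hW := by
    have hm := sqrtSqSubOne_ne_zero hz
    have hE := chebyshevExp_ne_zero s hz
    have hint := chebyshevCos_first_integral s (one_sub_div_two_mem_hypergeometricDomain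
      (one_add_mem_slitPlane_of_mem_legendreDomain hz))
    rw [wronskian, (hasDerivAt_chebyshevExp s hz).deriv] at hW
    have hfactor : s * chebyshevCos s z + sqrtSqSubOne z * deriv (chebyshevCos s) z = 0 := by
      refine (mul_eq_zero.1 ?_).resolve_left hE
      field_simp at hW
      linear_combination -hW
    -- `s u + √(z² - 1) u'` is a factor of the first integral, whose value is `s² ≠ 0`
    refine pow_ne_zero 2 hs (hint.symm.trans ?_)
    linear_combination (s * chebyshevCos s z - sqrtSqSubOne z * deriv (chebyshevCos s) z) * hfactor
      + deriv (chebyshevCos s) z ^ 2 * sqrtSqSubOne_sq hz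

/-- The branch of `√(1 - z²)` on the plane cut along `(-∞, -1]` and `[1, ∞)` that is positive on
`(-1, 1)`. -/
noncomputable def sqrtOneSubSq (z : ℂ) : ℂ := Complex.sqrt (1 - z) * Complex.sqrt (1 + z)

/-- The function `√(1 - z²) d/dz cos (s arccos z)`, that is `s sin (s arccos z)`. -/
noncomputable def chebyshevSin (s z : ℂ) : ℂ := sqrtOneSubSq z * deriv (chebyshevCos s) z

theorem sqrtOneSubSq_sq (z : ℂ) : sqrtOneSubSq z ^ 2 = 1 - z ^ 2 := by
  rw [sqrtOneSubSq, mul_pow, csqrt_sq, csqrt_sq]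
  ring

theorem sqrtOneSubSq_ne_zero {z : ℂ} (hz : z ∈ ferrersDomain) : sqrtOneSubSq z ≠ 0 :=
  mul_ne_zero (csqrt_ne_zero hz.1) (csqrt_ne_zero hz.2)

theorem hasDerivAt_sqrtOneSubSq {z : ℂ} (hz : z ∈ ferrersDomain) :
    HasDerivAt sqrtOneSubSq (-z / sqrtOneSubSq z) z := by
  have h₁ := csqrt_ne_zero hz.1
  have h₂ := csqrt_ne_zero hz.2
  refine ((hasDerivAt_csqrt_comp ((hasDerivAt_id' z).const_sub 1) hz.1).mul
    (hasDerivAt_csqrt_comp ((hasDerivAt_id' z).const_add 1) hz.2)).congr_deriv ?_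
  unfold sqrtOneSubSq
  field_simp
  linear_combination csqrt_sq (1 - z) - csqrt_sq (1 + z)

section ChebyshevSin

variable (s : ℂ)

theorem isChebyshevSolution_chebyshevCos_ferrersDomain :
    IsChebyshevSolution s ferrersDomain (chebyshevCos s) :=
  isChebyshevSolution_chebyshevCos s isOpen_ferrersDomain fun _ hz =>
    one_sub_div_two_mem_hypergeometricDomain hz.2

theorem hasDerivAt_chebyshevSin {z : ℂ} (hz : z ∈ ferrersDomain) :
    HasDerivAt (chebyshevSin s) (-s ^ 2 * chebyshevCos s z / sqrtOneSubSq z) z := by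
  have hu := isChebyshevSolution_chebyshevCos_ferrersDomain s
  have hm := sqrtOneSubSq_ne_zero hz
  refine ((hasDerivAt_sqrtOneSubSq hz).mul
    (hu.hasDerivAt_deriv isOpen_ferrersDomain hz)).congr_deriv ?_
  field_simp
  linear_combination hu.2 z hz + deriv (deriv (chebyshevCos s)) z * sqrtOneSubSq_sq z

theorem isChebyshevSolution_chebyshevSin :
    IsChebyshevSolution s ferrersDomain (chebyshevSin s) := by
  have hu := isChebyshevSolution_chebyshevCos_ferrersDomain s
  refine IsLinearODESolution.of_hasDerivAt isOpen_ferrersDomain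
    (fun z hz => hasDerivAt_chebyshevSin s hz)
    (fun z hz => ((hu.hasDerivAt isOpen_ferrersDomain hz).const_mul (-s ^ 2)).div
      (hasDerivAt_sqrtOneSubSq hz) (sqrtOneSubSq_ne_zero hz)) fun z hz => ?_
  have hm := sqrtOneSubSq_ne_zero hz
  rw [chebyshevSin, ← sqrtOneSubSq_sq z]
  field_simp
  ring

end ChebyshevSin

theorem isChebyshevSystem_ferrersDomain {s : ℂ} (hs : s ≠ 0) :
    IsChebyshevSystem s ferrersDomain (chebyshevCos s) (chebyshevSin s) where
  left := isChebyshevSolution_chebyshevCos_ferrersDomain s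
  right := isChebyshevSolution_chebyshevSin s
  wronskian_ne_zero z hz := by
    have hm := sqrtOneSubSq_ne_zero hz
    have hint := chebyshevCos_first_integral s (one_sub_div_two_mem_hypergeometricDomain hz.2)
    have hW : wronskian (chebyshevCos s) (chebyshevSin s) z = -s ^ 2 / sqrtOneSubSq z := by
      rw [wronskian, (hasDerivAt_chebyshevSin s hz).deriv, chebyshevSin]
      field_simp
      linear_combination -hint - deriv (chebyshevCos s) z ^ 2 * sqrtOneSubSq_sq z
    rw [hW]
    exact div_ne_zero (neg_ne_zero.2 (pow_ne_zero 2 hs)) hm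

/-! ### Legendre's equation -/

/-- `P` and `Q` are linearly independent solutions on `U` of the associated Legendre equation
`(1 - z²) y'' - 2z y' + (ν (ν + 1) - μ² / (1 - z²)) y = 0` of degree `ν` and order `μ`. -/
def IsLegendreSystem (ν μ : ℂ) (U : Set ℂ) (P Q : ℂ → ℂ) : Prop :=
  IsFundamentalSystem (fun z => 1 - z ^ 2) (fun z => -2 * z)
    (fun z => ν * (ν + 1) - μ ^ 2 / (1 - z ^ 2)) U P Q

/-- `k` is a continuous branch on `U` of a nonzero multiple of `(1 - z²) ^ (-1 / 4)`, the factor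
that turns solutions of Chebyshev's equation into solutions of Legendre's equation of order
`1 / 2`. -/
structure IsLegendreAmplitude (U : Set ℂ) (k : ℂ → ℂ) : Prop where
  continuousOn : ContinuousOn k U
  exists_pow_four_mul_eq : ∃ κ ≠ 0, ∀ z ∈ U, k z ^ 4 * (1 - z ^ 2) = κ

namespace IsLegendreAmplitude

variable {U : Set ℂ} {k : ℂ → ℂ} {z : ℂ}

theorem ne_zero (h : IsLegendreAmplitude U k) (hz : z ∈ U) : k z ≠ 0 := by
  obtain ⟨κ, hκ, hk⟩ := h.exists_pow_four_mul_eq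
  intro h0
  simp [← hk z hz, h0] at hκ

theorem one_sub_sq_ne_zero (h : IsLegendreAmplitude U k) (hz : z ∈ U) : 1 - z ^ 2 ≠ 0 := by
  obtain ⟨κ, hκ, hk⟩ := h.exists_pow_four_mul_eq
  intro h0
  simp [← hk z hz, h0] at hκ

theorem hasDerivAt (h : IsLegendreAmplitude U k) (hU : IsOpen U) (hz : z ∈ U) :
    HasDerivAt k (z / (2 * (1 - z ^ 2)) * k z) z := by
  obtain ⟨κ, hκ, hk⟩ := h.exists_pow_four_mul_eq
  have h1 := h.one_sub_sq_ne_zero hz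
  have hpow : ∀ᶠ v in nhds z, k v ^ 4 = κ / (1 - v ^ 2) := by
    filter_upwards [hU.mem_nhds hz] with v hv
    rw [eq_div_iff (h.one_sub_sq_ne_zero hv), hk v hv]
  have hquot : HasDerivAt (fun v => κ / (1 - v ^ 2)) (2 * z * κ / (1 - z ^ 2) ^ 2) z := by
    refine ((hasDerivAt_const z κ).div ((hasDerivAt_pow 2 z).const_sub 1) h1).congr_deriv ?_
    push_cast
    ring
  refine (hasDerivAt_of_pow_eq four_ne_zero (h.continuousOn.continuousAt (hU.mem_nhds hz)) hpow
    (div_ne_zero hκ h1) hquot).congr_deriv ?_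
  push_cast
  field_simp
  ring

end IsLegendreAmplitude

theorem IsChebyshevSystem.isLegendreSystem {s : ℂ} {U : Set ℂ} {u v k₁ k₂ : ℂ → ℂ}
    (h : IsChebyshevSystem s U u v) (hU : IsOpen U) (hk₁ : IsLegendreAmplitude U k₁)
    (hk₂ : IsLegendreAmplitude U k₂) :
    IsLegendreSystem (s - 1 / 2) (1 / 2) U (fun z => k₁ z * u z) (fun z => k₂ z * v z) := by
  have hρ (z : ℂ) (hz : z ∈ U) : HasDerivAt (fun z => z / (2 * (1 - z ^ 2)))
      ((1 + z ^ 2) / (2 * (1 - z ^ 2) ^ 2)) z := by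
    have h1 := hk₁.one_sub_sq_ne_zero hz
    refine ((hasDerivAt_id' z).div (((hasDerivAt_pow 2 z).const_sub 1).const_mul 2)
      (mul_ne_zero two_ne_zero h1)).congr_deriv ?_
    push_cast
    field_simp
    ring
  refine IsFundamentalSystem.gauge h hU (fun z hz => hk₁.hasDerivAt hU hz)
    (fun z hz => hk₂.hasDerivAt hU hz) (fun z hz => hk₁.ne_zero hz) (fun z hz => hk₂.ne_zero hz)
    hρ (fun z hz => ?_) fun z hz => ?_
  all_goals
    have h1 := hk₁.one_sub_sq_ne_zero hz
    field_simp
    ring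

theorem cpow_half_half_pow_four (u : ℂ) : (u ^ (1 / 2 / 2 : ℂ)) ^ 4 = u := by
  rw [← Complex.cpow_mul_nat]
  norm_num

theorem csqrt_pow_four (u : ℂ) : Complex.sqrt u ^ 4 = u ^ 2 := by
  linear_combination (Complex.sqrt u ^ 2 + u) * csqrt_sq u

theorem continuousAt_csqrt {u : ℂ} (hu : u ∈ Complex.slitPlane) : ContinuousAt Complex.sqrt u :=
  (hasDerivAt_csqrt_comp (hasDerivAt_id' u) hu).continuousAt

section FirstKind

theorem isLegendreAmplitude_of_mul_one_sub_eq {U : Set ℂ} {m : ℂ → ℂ} {c δ : ℂ} (hc : c ≠ 0)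
    (hδ : δ ≠ 0) (hm : ContinuousOn m U) (hslit : ∀ z ∈ U, m z ∈ Complex.slitPlane)
    (hU : ∀ z ∈ U, 1 + z ∈ Complex.slitPlane) (hmul : ∀ z ∈ U, m z * (1 - z) = δ * (1 + z)) :
    IsLegendreAmplitude U
      (fun z => c * m z ^ (1 / 2 / 2 : ℂ) / Complex.sqrt (1 - (1 - z) / 2)) where
  continuousOn := by
    have hw (z : ℂ) (hz : z ∈ U) := one_sub_div_two_mem_hypergeometricDomain (hU z hz)
    exact ((hm.cpow continuousOn_const hslit).const_mul c).div
      (fun z hz => (ContinuousAt.comp (f := fun z : ℂ => 1 - (1 - z) / 2)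
        (continuousAt_csqrt (hw z hz)) (by fun_prop)).continuousWithinAt)
      fun z hz => csqrt_ne_zero (hw z hz)
  exists_pow_four_mul_eq := by
    refine ⟨4 * c ^ 4 * δ, mul_ne_zero (mul_ne_zero (by norm_num) (pow_ne_zero 4 hc)) hδ,
      fun z hz => ?_⟩
    have h1 := Complex.slitPlane_ne_zero (hU z hz)
    rw [div_pow, mul_pow, cpow_half_half_pow_four, csqrt_pow_four,
      show 1 - (1 - z) / 2 = (1 + z) / 2 by ring]
    field_simp
    linear_combination 4 * (1 + z) * hmul z hz

variable (s : ℂ)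

theorem hypergeometricF_eq_chebyshevCos_div {z : ℂ} (hz : 1 + z ∈ Complex.slitPlane) :
    hypergeometricF (-(s - 1 / 2)) (s - 1 / 2 + 1) (1 - 1 / 2) ((1 - z) / 2) =
      chebyshevCos s z / Complex.sqrt (1 - (1 - z) / 2) := by
  rw [show -(s - 1 / 2) = 1 / 2 - s by ring, show s - 1 / 2 + 1 = 1 / 2 + s by ring,
    show (1 : ℂ) - 1 / 2 = 1 / 2 by norm_num]
  exact (hypergeometricF_half_sub_half_add_half s
    (one_sub_div_two_mem_hypergeometricDomain hz)).trans (div_eq_inv_mul _ _).symm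

theorem one_div_Gamma_half_ne_zero : 1 / Complex.Gamma (1 - 1 / 2) ≠ 0 :=
  one_div_ne_zero (Complex.Gamma_ne_zero_of_re_pos (by norm_num))

theorem exists_assocLegendreP_eqOn : ∃ k, IsLegendreAmplitude legendreDomain k ∧
    Set.EqOn (assocLegendreP (s - 1 / 2) (1 / 2)) (fun z => k z * chebyshevCos s z)
      legendreDomain := by
  refine ⟨_, isLegendreAmplitude_of_mul_one_sub_eq one_div_Gamma_half_ne_zero
    (m := fun z => (z + 1) / (z - 1)) (neg_ne_zero.2 one_ne_zero)
    (fun z hz => ContinuousAt.continuousWithinAt ?_)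
    (fun z hz => add_one_div_sub_one_mem_slitPlane hz)
    (fun z hz => one_add_mem_slitPlane_of_mem_legendreDomain hz) fun z hz => ?_, fun z hz => ?_⟩
  · exact ContinuousAt.div (by fun_prop) (by fun_prop) (Complex.slitPlane_ne_zero hz)
  · have h1 : z - 1 ≠ 0 := Complex.slitPlane_ne_zero hz
    field_simp
    ring
  · rw [assocLegendreP, hypergeometricF_eq_chebyshevCos_div s
      (one_add_mem_slitPlane_of_mem_legendreDomain hz)]
    ring

theorem exists_ferrersP_eqOn : ∃ k, IsLegendreAmplitude ferrersDomain k ∧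
    Set.EqOn (ferrersP (s - 1 / 2) (1 / 2)) (fun z => k z * chebyshevCos s z) ferrersDomain := by
  refine ⟨_, isLegendreAmplitude_of_mul_one_sub_eq one_div_Gamma_half_ne_zero
    (m := fun z => (1 + z) / (1 - z)) one_ne_zero
    (fun z hz => ContinuousAt.continuousWithinAt ?_)
    (fun z hz => one_add_div_one_sub_mem_slitPlane hz) (fun z hz => hz.2) fun z hz => ?_,
    fun z hz => ?_⟩
  · exact ContinuousAt.div (by fun_prop) (by fun_prop) (Complex.slitPlane_ne_zero hz.1)
  · have h1 : 1 - z ≠ 0 := Complex.slitPlane_ne_zero hz.1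
    field_simp
  · rw [ferrersP, hypergeometricF_eq_chebyshevCos_div s hz.2]
    ring

end FirstKind

section SecondKind

theorem isLegendreAmplitude_cpow_div_sqrtSqSubOne {c : ℂ} (hc : c ≠ 0) :
    IsLegendreAmplitude legendreDomain (fun z => c *
      ((z - 1) ^ (1 / 2 / 2 : ℂ) * (z + 1) ^ (1 / 2 / 2 : ℂ)) / sqrtSqSubOne z) where
  continuousOn := by
    have h₁ : ContinuousOn (fun z : ℂ => (z - 1) ^ (1 / 2 / 2 : ℂ)) legendreDomain :=
      (continuousOn_id.sub continuousOn_const).cpow continuousOn_const fun z hz => hz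
    have h₂ : ContinuousOn (fun z : ℂ => (z + 1) ^ (1 / 2 / 2 : ℂ)) legendreDomain :=
      (continuousOn_id.add continuousOn_const).cpow continuousOn_const fun z hz => by
        simpa using add_ofReal_mem_slitPlane hz (t := 1) (by norm_num)
    exact ((h₁.mul h₂).const_mul c).div
      (fun z hz => (hasDerivAt_sqrtSqSubOne hz).continuousAt.continuousWithinAt)
      fun z hz => sqrtSqSubOne_ne_zero hz
  exists_pow_four_mul_eq := by
    refine ⟨-c ^ 4, neg_ne_zero.2 (pow_ne_zero 4 hc), fun z hz => ?_⟩
    have hm := sqrtSqSubOne_ne_zero hz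
    rw [div_pow, mul_pow, mul_pow, cpow_half_half_pow_four, cpow_half_half_pow_four,
      div_mul_eq_mul_div, div_eq_iff (pow_ne_zero 4 hm)]
    linear_combination c ^ 4 * (sqrtSqSubOne z ^ 2 + z ^ 2 - 1) * sqrtSqSubOne_sq hz

theorem isLegendreAmplitude_csqrt_div_sqrtOneSubSq {c : ℂ} (hc : c ≠ 0) :
    IsLegendreAmplitude ferrersDomain (fun z => c * Complex.sqrt (1 - (1 - z) / 2) /
      (((1 + z) / (1 - z)) ^ (1 / 2 / 2 : ℂ) * sqrtOneSubSq z)) where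
  continuousOn := by
    intro z hz
    have hm0 : ((1 + z) / (1 - z)) ^ (1 / 2 / 2 : ℂ) ≠ 0 := fun h =>
      Complex.slitPlane_ne_zero (one_add_div_one_sub_mem_slitPlane hz)
        ((Complex.cpow_eq_zero_iff _ _).1 h).1
    refine (ContinuousAt.div (.const_mul (ContinuousAt.comp (f := fun z : ℂ => 1 - (1 - z) / 2)
      (continuousAt_csqrt (one_sub_div_two_mem_hypergeometricDomain hz.2)) (by fun_prop)) c)
      (.mul (.cpow ?_ continuousAt_const (one_add_div_one_sub_mem_slitPlane hz))
        (hasDerivAt_sqrtOneSubSq hz).continuousAt)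
      (mul_ne_zero hm0 (sqrtOneSubSq_ne_zero hz))).continuousWithinAt
    exact ContinuousAt.div (by fun_prop) (by fun_prop) (Complex.slitPlane_ne_zero hz.1)
  exists_pow_four_mul_eq := by
    refine ⟨c ^ 4 / 4, div_ne_zero (pow_ne_zero 4 hc) (by norm_num), fun z hz => ?_⟩
    have h1 : 1 + z ≠ 0 := Complex.slitPlane_ne_zero hz.2
    have h2 : 1 - z ≠ 0 := Complex.slitPlane_ne_zero hz.1
    have hfour : sqrtOneSubSq z ^ 4 = ((1 - z) * (1 + z)) ^ 2 := by
      linear_combination (sqrtOneSubSq z ^ 2 + (1 - z ^ 2)) * sqrtOneSubSq_sq z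
    rw [div_pow, mul_pow, mul_pow, cpow_half_half_pow_four, csqrt_pow_four, hfour,
      show 1 - (1 - z) / 2 = (1 + z) / 2 by ring, show 1 - z ^ 2 = (1 - z) * (1 + z) by ring]
    field_simp
    norm_num

variable {s : ℂ} (hs : 0 < s.re)
include hs

theorem exists_assocLegendreQ_eqOn : ∃ k, IsLegendreAmplitude legendreDomain k ∧
    Set.EqOn (assocLegendreQ (s - 1 / 2) (1 / 2)) (fun z => k z * chebyshevExp s z)
      legendreDomain := by
  have hΓ : Complex.Gamma (s + 1) ≠ 0 :=
    Complex.Gamma_ne_zero_of_re_pos (by rw [Complex.add_re, Complex.one_re]; positivity)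
  have hπ : (√Real.pi : ℂ) ≠ 0 := Complex.ofReal_ne_zero.2 (Real.sqrt_pos.2 Real.pi_pos).ne'
  have h2 : (2 : ℂ) ^ (s - 1 / 2 + 1) ≠ 0 := fun h =>
    two_ne_zero ((Complex.cpow_eq_zero_iff _ _).1 h).1
  have hc : Complex.exp (1 / 2 * Real.pi * Complex.I) * (√Real.pi * Complex.Gamma (s + 1) /
      (2 ^ (s - 1 / 2 + 1) * Complex.Gamma (s + 1))) ≠ 0 :=
    mul_ne_zero (Complex.exp_ne_zero _) (div_ne_zero (mul_ne_zero hπ hΓ) (mul_ne_zero h2 hΓ))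
  refine ⟨_, isLegendreAmplitude_cpow_div_sqrtSqSubOne hc, fun z hz => ?_⟩
  have hz0 := Complex.slitPlane_ne_zero (mem_slitPlane_of_mem_legendreDomain hz)
  have hzs : z ^ s ≠ 0 := fun h => hz0 ((Complex.cpow_eq_zero_iff _ _).1 h).1
  have hw := one_div_sq_mem_hypergeometricDomain hz
  rw [assocLegendreQ, show s - 1 / 2 + 1 / 2 + 1 = s + 1 by ring,
    show s - 1 / 2 + 1 / 2 + 2 = s + 2 by ring, show s - 1 / 2 + 3 / 2 = s + 1 by ring,
    hypergeometricF_half_succ_half_add_two s hs hw, Complex.cpow_add _ _ hz0, Complex.cpow_one]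
  simp only [chebyshevExp, Complex.cpow_neg, sqrtSqSubOne]
  field_simp

theorem exists_ferrersQ_eqOn : ∃ k, IsLegendreAmplitude ferrersDomain k ∧
    Set.EqOn (ferrersQ (s - 1 / 2) (1 / 2)) (fun z => k z * chebyshevSin s z) ferrersDomain := by
  have hs0 : s ≠ 0 := by rintro rfl; simp at hs
  have hΓ : Complex.Gamma (3 / 2) ≠ 0 := Complex.Gamma_ne_zero_of_re_pos (by norm_num)
  have hΓs : Complex.Gamma s ≠ 0 := Complex.Gamma_ne_zero_of_re_pos hs
  have hπ : (Real.pi : ℂ) ≠ 0 := Complex.ofReal_ne_zero.2 Real.pi_ne_zero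
  have hc : -(Real.pi : ℂ) / (2 * s * Complex.Gamma (3 / 2)) ≠ 0 :=
    div_ne_zero (neg_ne_zero.2 hπ) (mul_ne_zero (mul_ne_zero two_ne_zero hs0) hΓ)
  refine ⟨_, isLegendreAmplitude_csqrt_div_sqrtOneSubSq hc, fun z hz => ?_⟩
  have hm := sqrtOneSubSq_ne_zero hz
  have hw := one_sub_div_two_mem_hypergeometricDomain hz.2
  have hPneg : ferrersP (s - 1 / 2) (-(1 / 2)) z =
      1 / Complex.Gamma (3 / 2) * (((1 + z) / (1 - z)) ^ (1 / 2 / 2 : ℂ))⁻¹ *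
        (-1 / (2 * s ^ 2) * (Complex.sqrt (1 - (1 - z) / 2) *
          deriv (cosArcsinSqrt s) ((1 - z) / 2))) := by
    rw [ferrersP, show -(s - 1 / 2) = 1 / 2 - s by ring, show s - 1 / 2 + 1 = 1 / 2 + s by ring,
      show (1 : ℂ) - -(1 / 2) = 3 / 2 by norm_num,
      hypergeometricF_half_sub_half_add_three_halves s hs0 hw, neg_div, Complex.cpow_neg]
  rw [ferrersQ, hPneg, show (1 / 2 : ℂ) * Real.pi = Real.pi / 2 by ring, Complex.cos_pi_div_two,
    Complex.sin_pi_div_two, show s - 1 / 2 + 1 / 2 + 1 = s + 1 by ring,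
    show s - 1 / 2 - 1 / 2 + 1 = s by ring, Complex.Gamma_add_one s hs0]
  simp only [chebyshevSin, (hasDerivAt_chebyshevCos s hw).deriv]
  field_simp
  ring

theorem isLegendreSystem_assocLegendre :
    IsLegendreSystem (s - 1 / 2) (1 / 2) legendreDomain (assocLegendreP (s - 1 / 2) (1 / 2))
      (assocLegendreQ (s - 1 / 2) (1 / 2)) := by
  have hs0 : s ≠ 0 := by rintro rfl; simp at hs
  obtain ⟨k₁, hk₁, hP⟩ := exists_assocLegendreP_eqOn s
  obtain ⟨k₂, hk₂, hQ⟩ := exists_assocLegendreQ_eqOn hs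
  exact ((isChebyshevSystem_legendreDomain hs0).isLegendreSystem isOpen_legendreDomain hk₁
    hk₂).congr isOpen_legendreDomain hP hQ

theorem isLegendreSystem_ferrers :
    IsLegendreSystem (s - 1 / 2) (1 / 2) ferrersDomain (ferrersP (s - 1 / 2) (1 / 2))
      (ferrersQ (s - 1 / 2) (1 / 2)) := by
  have hs0 : s ≠ 0 := by rintro rfl; simp at hs
  obtain ⟨k₁, hk₁, hP⟩ := exists_ferrersP_eqOn s
  obtain ⟨k₂, hk₂, hQ⟩ := exists_ferrersQ_eqOn hs
  exact ((isChebyshevSystem_ferrersDomain hs0).isLegendreSystem isOpen_ferrersDomain hk₁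
    hk₂).congr isOpen_ferrersDomain hP hQ

end SecondKind

/-! ### The differential equation of the Dickson polynomials -/

theorem one_sub_sq_ne_zero_of_mem_legendreDomain {z : ℂ} (hz : z ∈ legendreDomain) :
    1 - z ^ 2 ≠ 0 := by
  rw [show 1 - z ^ 2 = -(z - 1) * (1 + z) by ring]
  exact mul_ne_zero (neg_ne_zero.2 (Complex.slitPlane_ne_zero hz))
    (Complex.slitPlane_ne_zero (one_add_mem_slitPlane_of_mem_legendreDomain hz))

theorem one_sub_sq_ne_zero_of_mem_ferrersDomain {z : ℂ} (hz : z ∈ ferrersDomain) :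
    1 - z ^ 2 ≠ 0 := by
  rw [show 1 - z ^ 2 = (1 - z) * (1 + z) by ring]
  exact mul_ne_zero (Complex.slitPlane_ne_zero hz.1) (Complex.slitPlane_ne_zero hz.2)

theorem IsLegendreSystem.isFundamentalSystem_div {ν μ r : ℂ} {U V : Set ℂ} {P Q : ℂ → ℂ}
    (h : IsLegendreSystem ν μ U P Q) (hU : IsOpen U) (hV : IsOpen V)
    (hr : r ≠ 0) (hmaps : ∀ x ∈ V, x / (2 * r) ∈ U) :
    IsFundamentalSystem (fun x => x ^ 2 - 4 * r ^ 2) (fun x => 2 * x)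
      (fun x => -(ν * (ν + 1)) - 4 * r ^ 2 * μ ^ 2 / (x ^ 2 - 4 * r ^ 2)) V
      (fun x => P (x / (2 * r))) (fun x => Q (x / (2 * r))) := by
  have haffine (x : ℂ) : 1 / (2 * r) * x + 0 = x / (2 * r) := by ring
  have hcomp := h.comp_affine hU hV (α := 1 / (2 * r)) (β := 0)
    (one_div_ne_zero (mul_ne_zero two_ne_zero hr)) fun x hx => by rw [haffine]; exact hmaps x hx
  simp only [haffine] at hcomp
  refine hcomp.rescale (fun _ => -4 * r ^ 2) (fun x _ => ?_) (fun x _ => ?_) fun x _ => ?_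
  · field_simp
    ring
  · field_simp
    ring
  · have hX : x ^ 2 - 4 * r ^ 2 = -4 * r ^ 2 * (1 - (x / (2 * r)) ^ 2) := by
      field_simp
      ring
    rw [hX]
    field_simp
    ring

theorem IsLegendreSystem.isFundamentalSystem_one_div_mul {s r : ℂ} {U V : Set ℂ} {P Q g : ℂ → ℂ}
    (h : IsLegendreSystem (s - 1 / 2) (1 / 2) U P Q) (hU : IsOpen U)
    (hV : IsOpen V) (hr : r ≠ 0) (hmaps : ∀ x ∈ V, x / (2 * r) ∈ U) (hg : ContinuousOn g V)
    (hg4 : ∀ x ∈ V, g x ^ 4 = x ^ 2 - 4 * r ^ 2) (hX : ∀ x ∈ V, x ^ 2 - 4 * r ^ 2 ≠ 0) :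
    IsFundamentalSystem (fun x => x ^ 2 - 4 * r ^ 2) (fun x => 3 * x) (fun _ => -(s ^ 2 - 1)) V
      (fun x => 1 / g x * P (x / (2 * r))) (fun x => 1 / g x * Q (x / (2 * r))) := by
  have hXderiv (x : ℂ) : HasDerivAt (fun x => x ^ 2 - 4 * r ^ 2) (2 * x) x := by
    simpa using (hasDerivAt_pow 2 x).sub_const (4 * r ^ 2)
  have hg0 (x : ℂ) (hx : x ∈ V) : g x ≠ 0 := fun h0 => hX x hx (by
    rw [← hg4 x hx, h0, zero_pow four_ne_zero])
  have he (x : ℂ) (hx : x ∈ V) : HasDerivAt (fun x => 1 / g x)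
      (-x / (2 * (x ^ 2 - 4 * r ^ 2)) * (1 / g x)) x := by
    refine (hasDerivAt_one_div_of_pow_eq four_ne_zero (hg.continuousAt (hV.mem_nhds hx))
      (Filter.eventually_of_mem (hV.mem_nhds hx) hg4) (hX x hx) (hXderiv x)).congr_deriv ?_
    push_cast
    field_simp
    ring
  have hρ (x : ℂ) (hx : x ∈ V) : HasDerivAt (fun x => -x / (2 * (x ^ 2 - 4 * r ^ 2)))
      ((x ^ 2 + 4 * r ^ 2) / (2 * (x ^ 2 - 4 * r ^ 2) ^ 2)) x := by
    have hXx := hX x hx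
    refine ((hasDerivAt_id' x).fun_neg.div ((hXderiv x).const_mul 2)
      (mul_ne_zero two_ne_zero hXx)).congr_deriv ?_
    field_simp
    ring
  refine (h.isFundamentalSystem_div hU hV hr hmaps).gauge hV he he
    (fun x hx => one_div_ne_zero (hg0 x hx)) (fun x hx => one_div_ne_zero (hg0 x hx)) hρ
    (fun x hx => ?_) fun x hx => ?_
  all_goals
    have hXx := hX x hx
    field_simp
    ring

section DicksonEquation

variable {n : ℕ} {a : ℂ} {V : Set ℂ} {F G : ℂ → ℂ}

theorem isHomogeneousSolution_iff_isLinearODESolution :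
    IsHomogeneousSolution n a V F ↔ IsLinearODESolution (fun x => x ^ 2 - 4 * a)
      (fun x => 3 * x) (fun _ => -(n : ℂ) ^ 2) V F := by
  simp only [IsHomogeneousSolution, IsLinearODESolution, dicksonOperator, sub_eq_add_neg, neg_mul]

theorem isInhomogeneousSolution_iff_isHomogeneousSolution_sub (hV : IsOpen V)
    (hG : IsInhomogeneousSolution n a V G) :
    IsInhomogeneousSolution n a V F ↔ IsHomogeneousSolution n a V (fun x => F x - G x) := by
  have hdiff : DifferentiableOn ℂ F V ↔ DifferentiableOn ℂ (fun x => F x - G x) V :=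
    ⟨fun h => h.sub hG.1, fun h => (h.add hG.1).congr fun x _ => (sub_add_cancel _ _).symm⟩
  refine and_congr_right_iff.2 (fun hF => forall₂_congr fun x hx => ?_) |>.trans
    (and_congr_left_iff.2 fun _ => hdiff)
  have hderiv {y : ℂ} (hy : y ∈ V) : deriv (fun x => F x - G x) y = deriv F y - deriv G y :=
    deriv_fun_sub (hF.differentiableAt (hV.mem_nhds hy)) (hG.1.differentiableAt (hV.mem_nhds hy))
  have hderiv₂ : deriv (deriv fun x => F x - G x) x = deriv (deriv F) x - deriv (deriv G) x := by
    rw [(Filter.eventuallyEq_of_mem (hV.mem_nhds hx) fun y hy => hderiv hy).deriv_eq]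
    exact deriv_fun_sub ((hF.deriv hV).differentiableAt (hV.mem_nhds hx))
      ((hG.1.deriv hV).differentiableAt (hV.mem_nhds hx))
  have hop : dicksonOperator n a (fun x => F x - G x) x =
      dicksonOperator n a F x - dicksonOperator n a G x := by
    simp only [dicksonOperator, hderiv hx, hderiv₂]
    ring
  rw [hop, hG.2 x hx, sub_eq_zero]

theorem isHomogeneousSolution_iff_exists_complementarySolution {U : Set ℂ} {P Q g : ℂ → ℂ} {r : ℂ}
    (h : IsLegendreSystem (legendreDegree n) (1 / 2) U P Q) (hU : IsOpen U)
    (hU1 : ∀ z ∈ U, 1 - z ^ 2 ≠ 0) (ha : a ≠ 0) (hr : r ^ 2 = a) (hV : IsOpen V)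
    (hc : IsPreconnected V) (hmaps : ∀ x ∈ V, x / (2 * r) ∈ U) (hg : ContinuousOn g V)
    (hg4 : ∀ x ∈ V, g x ^ 4 = x ^ 2 - 4 * a) :
    IsHomogeneousSolution n a V F ↔
      ∃ A B : ℂ, ∀ x ∈ V, F x = complementarySolution P Q g r A B x := by
  subst hr
  have hr0 : r ≠ 0 := pow_ne_zero_iff two_ne_zero |>.1 ha
  have hX (x : ℂ) (hx : x ∈ V) : x ^ 2 - 4 * r ^ 2 ≠ 0 := by
    rw [show x ^ 2 - 4 * r ^ 2 = -(4 * r ^ 2) * (1 - (x / (2 * r)) ^ 2) by field_simp; ring]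
    exact mul_ne_zero (neg_ne_zero.2 (mul_ne_zero (by norm_num) ha)) (hU1 _ (hmaps x hx))
  have hs : (√((n : ℝ) ^ 2 + 1) : ℂ) ^ 2 - 1 = (n : ℂ) ^ 2 := by
    rw [← Complex.ofReal_pow, Real.sq_sqrt (by positivity)]
    push_cast
    ring
  have hsys := h.isFundamentalSystem_one_div_mul hU hV hr0 hmaps hg hg4 hX
  rw [hs] at hsys
  rw [isHomogeneousSolution_iff_isLinearODESolution, hsys.isLinearODESolution_iff hV hc hX]
  refine exists₂_congr fun A B => forall₂_congr fun x _ => ?_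
  rw [complementarySolution]
  ring_nf

end DicksonEquation

/-! ### Dickson polynomials -/

section DicksonPolynomials

open Polynomial

variable {R : Type*} [CommRing R] (a : R) (n : ℕ)

theorem dickson_one_succ :
    dickson 1 a (n + 1) = 2 * dickson 2 a (n + 1) - X * dickson 2 a n := by
  induction n using Nat.twoStepInduction with
  | zero => norm_num [dickson]; ring
  | one => norm_num [dickson]; ring
  | more n h₁ h₂ =>
    rw [dickson_add_two 1 a (n + 1), h₁, h₂, dickson_add_two 2 a (n + 1), dickson_add_two 2 a n]
    ring

theorem dickson_three_succ : dickson 3 a (n + 1) = X * dickson 2 a n := by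
  induction n using Nat.twoStepInduction with
  | zero => norm_num [dickson]
  | one => norm_num [dickson]
  | more n h₁ h₂ =>
    rw [dickson_add_two 3 a (n + 1), h₁, h₂, dickson_add_two 2 a n]
    ring

theorem derivative_dickson_one_succ :
    derivative (dickson 1 a (n + 1)) = (n + 1 : R[X]) * dickson 2 a n := by
  induction n using Nat.twoStepInduction with
  | zero => norm_num [dickson]
  | one => norm_num [dickson]; ring
  | more n h₁ h₂ =>
    rw [dickson_add_two 1 a (n + 1)]
    simp only [derivative_sub, derivative_mul, derivative_X, derivative_C, h₁, h₂]
    rw [dickson_one_succ, dickson_add_two 2 a n]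
    push_cast
    ring

theorem sq_sub_mul_dickson_two :
    (X ^ 2 - 4 * C a) * dickson 2 a n = 2 * dickson 1 a (n + 2) - X * dickson 1 a (n + 1) := by
  rw [dickson_one_succ a (n + 1), dickson_one_succ, dickson_add_two]
  ring

theorem sq_sub_mul_derivative_dickson_two :
    (X ^ 2 - 4 * C a) * derivative (dickson 2 a n) + X * dickson 2 a n =
      (n + 1 : R[X]) * dickson 1 a (n + 1) := by
  have h := congrArg derivative (sq_sub_mul_dickson_two a n)
  have h₁ := derivative_dickson_one_succ a n
  have h₂ := derivative_dickson_one_succ a (n + 1)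
  simp only [derivative_mul, derivative_sub, derivative_X_pow, derivative_C, derivative_X,
    derivative_ofNat, h₁, h₂] at h
  push_cast at h
  rw [map_ofNat] at h
  linear_combination h - (n + 2 : R[X]) * dickson_one_succ a n

/-- The operator `p ↦ (X² - 4a) p'' + 3X p' - n² p` on polynomials. -/
noncomputable def polynomialDicksonOperator (p : R[X]) : R[X] :=
  (X ^ 2 - 4 * C a) * derivative (derivative p) + 3 * X * derivative p - (n : R[X]) ^ 2 * p

theorem polynomialDicksonOperator_dickson_three :
    polynomialDicksonOperator a n (dickson 3 a n) = 2 * (n : R[X]) * dickson 1 a n := by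
  rcases n with _ | n
  · norm_num [polynomialDicksonOperator]
  have h := sq_sub_mul_derivative_dickson_two a n
  have h' := congrArg derivative h
  simp only [derivative_mul, derivative_add, derivative_sub, derivative_X_pow, derivative_C,
    derivative_X, derivative_ofNat, derivative_natCast, derivative_one,
    derivative_dickson_one_succ] at h'
  rw [polynomialDicksonOperator, dickson_three_succ]
  simp only [derivative_mul, derivative_add, derivative_X, derivative_one]
  push_cast at h' ⊢
  rw [map_ofNat] at h'
  linear_combination X * h' + 2 * h

theorem coeff_polynomialDicksonOperator (p : R[X]) (k : ℕ) :
    (polynomialDicksonOperator a n p).coeff k =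
      ((k : R) * (k + 2) - (n : R) ^ 2) * p.coeff k
        - 4 * a * (k + 2) * (k + 1) * p.coeff (k + 2) := by
  have heuler : polynomialDicksonOperator a n p = X * (X * derivative (derivative p))
      - C (4 * a) * derivative (derivative p) + C 3 * (X * derivative p) - C ((n : R) ^ 2) * p := by
    simp only [polynomialDicksonOperator, map_mul, map_pow, map_natCast, map_ofNat]
    ring
  rw [heuler]
  simp only [coeff_sub, coeff_add, coeff_C_mul]
  rcases k with _ | _ | k
  · simp [coeff_derivative]; ring
  · simp [coeff_derivative]; ring
  · simp only [coeff_X_mul, coeff_derivative]; push_cast; ring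

variable (m : ℕ)

theorem dickson_zero_eq_C : dickson m a 0 = C (3 - m : R) := by simp [map_ofNat]

theorem natDegree_dickson_le : (dickson m a n).natDegree ≤ n := by
  induction n using Nat.twoStepInduction with
  | zero => rw [dickson_zero_eq_C, natDegree_C]
  | one => simpa using natDegree_X_le
  | more n h₁ h₂ =>
    rw [dickson_add_two]
    refine (natDegree_sub_le _ _).trans (max_le ?_ ?_)
    · exact natDegree_mul_le.trans (by have := natDegree_X_le (R := R); omega)
    · exact (natDegree_C_mul_le _ _).trans (by omega)

theorem coeff_dickson_of_not_even {j : ℕ} (hj : ¬Even (n + j)) : (dickson m a n).coeff j = 0 := by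
  induction n using Nat.twoStepInduction generalizing j with
  | zero =>
    rw [dickson_zero_eq_C, coeff_C, if_neg]
    rintro rfl
    exact hj Even.zero
  | one =>
    rw [dickson_one, coeff_X, if_neg]
    rintro rfl
    exact hj even_two
  | more n h₁ h₂ =>
    rw [dickson_add_two, coeff_sub, coeff_C_mul, h₁ (by grind)]
    rcases j with _ | j
    · simp
    · rw [coeff_X_mul, h₂ (by grind)]
      simp

end DicksonPolynomials

section ParticularSolution

open Polynomial

variable {n : ℕ} {a : ℂ} {b : ℕ → ℂ}

theorem coeff_two_mul_natCast_mul (p : ℂ[X]) (k : ℕ) :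
    (2 * (n : ℂ[X]) * p).coeff k = 2 * n * p.coeff k := by
  rw [show 2 * (n : ℂ[X]) = C (2 * (n : ℂ)) by simp [map_ofNat], coeff_C_mul]

theorem dicksonRecurrence_iff (ha : a ≠ 0) : DicksonRecurrence n a b ↔ ∀ k ≤ n,
    ((k : ℂ) * (k + 2) - (n : ℂ) ^ 2) * b k - 4 * a * (k + 2) * (k + 1) * b (k + 2) =
      2 * n * (dicksonD n a).coeff k := by
  refine forall₂_congr fun k hk => ?_
  have h1 : (k : ℂ) + 1 ≠ 0 := by exact_mod_cast k.succ_ne_zero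
  have h2 : (k : ℂ) + 2 ≠ 0 := by exact_mod_cast (k + 1).succ_ne_zero
  by_cases hpar : Even (n + k)
  · have hsame : Odd n ∧ Odd k ∨ Even n ∧ Even k := by grind
    have hdiff : ¬(Odd n ∧ Even k ∨ Even n ∧ Odd k) := by grind
    have hindex : n - 2 * ((n - k) / 2) = k := by grind
    simp only [hsame, hdiff, false_imp_iff, true_imp_iff, true_and, hindex]
    field_simp
    constructor <;> intro h <;> linear_combination -h
  · have hsame : ¬(Odd n ∧ Odd k ∨ Even n ∧ Even k) := by grind
    have hdiff : Odd n ∧ Even k ∨ Even n ∧ Odd k := by grind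
    simp only [hsame, hdiff, false_imp_iff, true_imp_iff, and_true, dicksonD,
      coeff_dickson_of_not_even a n 1 hpar]
    field_simp
    constructor <;> intro h <;> linear_combination -h

/-- `F_p = ∑_{k=0}^{n} b_k X^k` as a polynomial. -/
noncomputable def particularPolynomial (n : ℕ) (b : ℕ → ℂ) : ℂ[X] :=
  ∑ k ∈ Finset.range (n + 1), C (b k) * X ^ k

theorem coeff_particularPolynomial (k : ℕ) :
    (particularPolynomial n b).coeff k = if k ≤ n then b k else 0 := by
  simp [particularPolynomial, coeff_X_pow]

theorem particularSolution_eq_eval :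
    particularSolution n b = fun x => (particularPolynomial n b).eval x := by
  funext x
  simp [particularSolution, particularPolynomial, eval_finsetSum]

theorem dicksonRecurrence_iff_polynomialDicksonOperator (ha : a ≠ 0) (hb₁ : b (n + 1) = 0)
    (hb₂ : b (n + 2) = 0) : DicksonRecurrence n a b ↔
      polynomialDicksonOperator a n (particularPolynomial n b) = 2 * (n : ℂ[X]) * dicksonD n a := by
  have hcoeff (k : ℕ) (hk : k ≤ n + 2) : (particularPolynomial n b).coeff k = b k := by
    rw [coeff_particularPolynomial, ite_eq_left_iff]
    intro h
    obtain rfl | rfl : k = n + 1 ∨ k = n + 2 := by omega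
    exacts [hb₁.symm, hb₂.symm]
  simp only [dicksonRecurrence_iff ha, Polynomial.ext_iff, coeff_polynomialDicksonOperator,
    coeff_two_mul_natCast_mul]
  constructor
  · intro h k
    rcases le_or_gt k n with hk | hk
    · rw [hcoeff k (by omega), hcoeff (k + 2) (by omega), h k hk]
    · rw [coeff_particularPolynomial, coeff_particularPolynomial, if_neg (by omega),
        if_neg (by omega), dicksonD,
        coeff_eq_zero_of_natDegree_lt ((natDegree_dickson_le a n 1).trans_lt hk)]
      ring
  · intro h k hk
    rw [← h k, hcoeff k (by omega), hcoeff (k + 2) (by omega)]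

theorem dicksonRecurrence_coeff_dicksonF (ha : a ≠ 0) :
    DicksonRecurrence n a (dicksonF n a).coeff := by
  refine (dicksonRecurrence_iff ha).2 fun k _ => ?_
  rw [← coeff_polynomialDicksonOperator, dicksonF, polynomialDicksonOperator_dickson_three,
    coeff_two_mul_natCast_mul, dicksonD]

theorem coeff_dicksonF_of_lt {k : ℕ} (hk : n < k) : (dicksonF n a).coeff k = 0 :=
  coeff_eq_zero_of_natDegree_lt ((natDegree_dickson_le a n 3).trans_lt hk)

theorem dicksonOperator_eval (p : ℂ[X]) (x : ℂ) :
    dicksonOperator n a (fun y => p.eval y) x = (polynomialDicksonOperator a n p).eval x := by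
  have hderiv (q : ℂ[X]) : deriv (fun y => q.eval y) = fun y => (derivative q).eval y :=
    funext fun _ => q.deriv
  simp [dicksonOperator, polynomialDicksonOperator, hderiv]

theorem isInhomogeneousSolution_eval_iff (p : ℂ[X]) :
    IsInhomogeneousSolution n a Set.univ (fun y => p.eval y) ↔
      polynomialDicksonOperator a n p = 2 * (n : ℂ[X]) * dicksonD n a := by
  have hode : (∀ x ∈ Set.univ, dicksonOperator n a (fun y => p.eval y) x =
      2 * n * (dicksonD n a).eval x) ↔
      ∀ x, (polynomialDicksonOperator a n p).eval x = (2 * (n : ℂ[X]) * dicksonD n a).eval x := by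
    simp [dicksonOperator_eval]
  rw [IsInhomogeneousSolution, hode]
  exact ⟨fun h => Polynomial.funext h.2, fun h => ⟨p.differentiable.differentiableOn, by simp [h]⟩⟩

theorem isInhomogeneousSolution_particularSolution_iff (ha : a ≠ 0) (hb₁ : b (n + 1) = 0)
    (hb₂ : b (n + 2) = 0) :
    IsInhomogeneousSolution n a Set.univ (particularSolution n b) ↔ DicksonRecurrence n a b := by
  rw [particularSolution_eq_eval, isInhomogeneousSolution_eval_iff,
    dicksonRecurrence_iff_polynomialDicksonOperator ha hb₁ hb₂]

theorem isInhomogeneousSolution_dicksonF :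
    IsInhomogeneousSolution n a Set.univ (fun x => (dicksonF n a).eval x) :=
  (isInhomogeneousSolution_eval_iff _).2 (polynomialDicksonOperator_dickson_three a n)

theorem IsInhomogeneousSolution.mono {F : ℂ → ℂ} {U V : Set ℂ}
    (h : IsInhomogeneousSolution n a U F) (hVU : V ⊆ U) : IsInhomogeneousSolution n a V F :=
  ⟨h.1.mono hVU, fun x hx => h.2 x (hVU hx)⟩

end ParticularSolution

theorem exists_isLegendreSystem (n : ℕ) {r : ℂ} {V : Set ℂ} {P Q : ℂ → ℂ}
    (hPQ : (P = assocLegendreP (legendreDegree n) (1 / 2) ∧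
        Q = assocLegendreQ (legendreDegree n) (1 / 2) ∧
        ∀ x ∈ V, x / (2 * r) ∈ legendreDomain) ∨
      (P = ferrersP (legendreDegree n) (1 / 2) ∧ Q = ferrersQ (legendreDegree n) (1 / 2) ∧
        ∀ x ∈ V, x / (2 * r) ∈ ferrersDomain)) :
    ∃ U, IsOpen U ∧ (∀ z ∈ U, 1 - z ^ 2 ≠ 0) ∧ (∀ x ∈ V, x / (2 * r) ∈ U) ∧
      IsLegendreSystem (legendreDegree n) (1 / 2) U P Q := by
  have hs : 0 < ((√((n : ℝ) ^ 2 + 1) : ℝ) : ℂ).re := by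
    rw [Complex.ofReal_re]
    positivity
  rcases hPQ with ⟨rfl, rfl, hmaps⟩ | ⟨rfl, rfl, hmaps⟩
  · exact ⟨legendreDomain, isOpen_legendreDomain,
      fun _ hz => one_sub_sq_ne_zero_of_mem_legendreDomain hz, hmaps,
      isLegendreSystem_assocLegendre hs⟩
  · exact ⟨ferrersDomain, isOpen_ferrersDomain,
      fun _ hz => one_sub_sq_ne_zero_of_mem_ferrersDomain hz, hmaps, isLegendreSystem_ferrers hs⟩

theorem theorem1p2 (n : ℕ) (a : ℂ) (ha : a ≠ 0) :
    -- the particular solution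
    (∃ b : ℕ → ℂ, b (n + 1) = 0 ∧ b (n + 2) = 0 ∧ DicksonRecurrence n a b) ∧
    (∀ b : ℕ → ℂ, b (n + 1) = 0 → b (n + 2) = 0 →
      (IsInhomogeneousSolution n a Set.univ (particularSolution n b) ↔
        DicksonRecurrence n a b)) ∧
    -- the general solutions, for either pair of associated Legendre functions,
    -- any square root of `a` and any branch of the fourth root of `x² - 4a`
    (∀ r : ℂ, r ^ 2 = a →
      ∀ V : Set ℂ, IsOpen V → IsPreconnected V →
      ∀ g : ℂ → ℂ, ContinuousOn g V → (∀ x ∈ V, g x ^ 4 = x ^ 2 - 4 * a) →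
      ∀ P Q : ℂ → ℂ,
        ((P = assocLegendreP (legendreDegree n) (1 / 2) ∧
            Q = assocLegendreQ (legendreDegree n) (1 / 2) ∧
            ∀ x ∈ V, x / (2 * r) ∈ legendreDomain) ∨
          (P = ferrersP (legendreDegree n) (1 / 2) ∧
            Q = ferrersQ (legendreDegree n) (1 / 2) ∧
            ∀ x ∈ V, x / (2 * r) ∈ ferrersDomain)) →
        (∀ F : ℂ → ℂ, IsHomogeneousSolution n a V F ↔
          ∃ A B : ℂ, ∀ x ∈ V, F x = complementarySolution P Q g r A B x) ∧
        (∀ b : ℕ → ℂ, b (n + 1) = 0 → b (n + 2) = 0 → DicksonRecurrence n a b →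
          (∀ F : ℂ → ℂ, IsInhomogeneousSolution n a V F ↔
            ∃ A B : ℂ, ∀ x ∈ V,
              F x = complementarySolution P Q g r A B x + particularSolution n b x) ∧
          ∃ A B : ℂ, ∀ x ∈ V, (dicksonF n a).eval x =
            complementarySolution P Q g r A B x + particularSolution n b x)) := by
  have hp (b : ℕ → ℂ) (h₁ : b (n + 1) = 0) (h₂ : b (n + 2) = 0) :=
    isInhomogeneousSolution_particularSolution_iff ha h₁ h₂
  refine ⟨⟨(dicksonF n a).coeff, coeff_dicksonF_of_lt (by omega), coeff_dicksonF_of_lt (by omega),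
    dicksonRecurrence_coeff_dicksonF ha⟩, hp, fun r hr V hV hc g hg hg4 P Q hPQ => ?_⟩
  obtain ⟨U, hU, hU1, hmaps, hLegendre⟩ := exists_isLegendreSystem n hPQ
  have hhom (F : ℂ → ℂ) : IsHomogeneousSolution n a V F ↔
      ∃ A B : ℂ, ∀ x ∈ V, F x = complementarySolution P Q g r A B x :=
    isHomogeneousSolution_iff_exists_complementarySolution hLegendre hU hU1 ha hr hV hc hmaps hg hg4
  refine ⟨hhom, fun b h₁ h₂ hb => ?_⟩
  have hinhom (F : ℂ → ℂ) : IsInhomogeneousSolution n a V F ↔ ∃ A B : ℂ, ∀ x ∈ V,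
      F x = complementarySolution P Q g r A B x + particularSolution n b x := by
    rw [isInhomogeneousSolution_iff_isHomogeneousSolution_sub hV
      (((hp b h₁ h₂).2 hb).mono V.subset_univ), hhom]
    simp only [sub_eq_iff_eq_add]
  exact ⟨hinhom, (hinhom _).1 (isInhomogeneousSolution_dicksonF.mono V.subset_univ)⟩
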